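/- Let $G$ be a group, let $H\leq G$ be a subgroup of finite index, and let $R$ be a commutative ring on which $G$ acts by ring automorphisms (actions are written on the left; a right action is treated by $a^g=g^{-1}a$). For $K\in\{G,H\}$, a $K$-algebra over $R$ is an $R$-algebra $A$ on which $K$ acts by ring automorphisms such that $k(ra)=(kr)(ka)$ for $k\in K$, $r\in R$, $a\in A$. Tensor products of $K$-algebras over $R$ carry the diagonal action. If $P$ is an $R$-module with an additive $K$-action such that $k(rp)=(kr)(kp)$, then $\operatorname{End}_R P$ is a $K$-algebra via $(k\alpha)(p)=k\,\alpha(k^{-1}p)$. Two $K$-algebras $A$, $B$ over $R$ are called equivalent if there are such modules $P$, $Q$ that are progenerators over $R$ (finitely generated projective generators) with $A\otimes_R\operatorname{End}_R P\cong B\otimes_R\operatorname{End}_R Q$ as $K$-algebras over $R$. The Brauer-Clifford group $\operatorname{BrCliff}(K,R)$ is the group of equivalence classes $[A]$ of $K$-algebras over $R$ that are Azumaya over $R$, with multiplication induced by $\otimes_R$. For an $H$-algebra $A$ over $R$, let $RG\otimes_{RH}A=\bigoplus_{\omega\in G/H}A_\omega$, where $RG$ is the skew group ring and $A_{gH}=g\otimes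 A$, be the induced module. Each $A_\omega$ is an $R$-algebra via $(g\otimes a)(g\otimes b)=g\otimes ab$ and $r(g\otimes a)=g\otimes (g^{-1}r)a$. The tensor induced $G$-algebra is $A^{\otimes G}=\bigotimes_{\omega\in G/H}A_\omega$ (tensor product over $R$), with $G$-action $g\bigl(\bigotimes_\omega a_\omega\bigr)=\bigotimes_\omega g\,a_{g^{-1}\omega}$. Then: 1. If $A$ and $B$ are equivalent $H$-algebras over $R$, then $A^{\otimes G}$ and $B^{\otimes G}$ are equivalent $G$-algebras over $R$. 2. If an $H$-algebra $A$ is Azumaya over $R$, then $A^{\otimes G}$ is Azumaya over $R$. 3. Consequently there is a unique group homomorphism $\operatorname{Cores}_H^G\colon\operatorname{BrCliff}(H,R)\to\operatorname{BrCliff}(G,R)$ with $\operatorname{Cores}_H^G([A])=[A^{\otimes G}]$ for every Azumaya $H$-algebra $A$ over $R$. -/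

import Mathlib

open scoped TensorProduct

universe u v w

namespace BrauerClifford

/-! ### Preliminaries on modules over a commutative ring -/

section Modules

variable (R : Type*) [CommRing R]

/-- An `R`-module `P` is a generator if its trace ideal (the ideal generated by all values `f p`
of linear forms `f : P → R`) is all of `R`. -/
def IsGenerator (P : Type*) [AddCommGroup P] [Module R P] : Prop :=
  Ideal.span {r : R | ∃ (f : P →ₗ[R] R) (p : P), f p = r} = ⊤

/-- A progenerator: a finitely generated projective generator. -/
structure IsProgenerator (P : Type*) [AddCommGroup P] [Module R P] : Prop where
  finite : Module.Finite R P
  projective : Module.Projective R P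
  generator : IsGenerator R P

variable {R}
variable {P Q : Type*} [AddCommGroup P] [Module R P] [AddCommGroup Q] [Module R Q]

theorem exists_dual_basis (R : Type*) [CommRing R] (P : Type*) [AddCommGroup P] [Module R P]
    [Module.Finite R P] [Module.Projective R P] :
    ∃ (n : ℕ) (m : Fin n → P) (f : Fin n → (P →ₗ[R] R)), ∀ x, ∑ i, f i x • m i = x := by
  obtain ⟨n, f, g, -, -, h⟩ := Module.Finite.exists_comp_eq_id_of_projective R P
  refine ⟨n, fun i => f (Pi.single i 1), fun i => (LinearMap.proj i).comp g, fun x => ?_⟩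
  have h1 : f (g x) = x := LinearMap.congr_fun h x
  conv_rhs => rw [← h1, pi_eq_sum_univ' (g x)]
  simp [map_sum]

theorem IsGenerator.of_faithful [Module.Finite R P] [Module.Projective R P] [FaithfulSMul R P] :
    IsGenerator R P := by
  unfold IsGenerator
  set T := Ideal.span {r : R | ∃ (f : P →ₗ[R] R) (p : P), f p = r} with hT
  obtain ⟨n, m, f, h⟩ := exists_dual_basis R P
  have hle : (⊤ : Submodule R P) ≤ T • ⊤ := by
    intro x _
    rw [← h x]
    exact Submodule.sum_mem _ fun i _ =>
      Submodule.smul_mem_smul (Ideal.subset_span ⟨f i, x, rfl⟩) trivial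
  obtain ⟨r, hr, hr0⟩ := Submodule.exists_sub_one_mem_and_smul_eq_zero_of_fg_of_le_smul T ⊤
    Module.Finite.fg_top hle
  have : r = 0 := by
    refine FaithfulSMul.eq_of_smul_eq_smul (α := P) fun a => ?_
    rw [hr0 a trivial, zero_smul]
  rw [this, zero_sub] at hr
  exact (Ideal.eq_top_iff_one _).2 (by simpa using T.neg_mem hr)

theorem IsGenerator.tensor (hP : IsGenerator R P) (hQ : IsGenerator R Q) :
    IsGenerator R (P ⊗[R] Q) := by
  unfold IsGenerator at *
  rw [← Ideal.top_mul ⊤]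
  nth_rewrite 1 [← hP]
  rw [← hQ, Ideal.span_mul_span']
  refine le_antisymm ?_ (Ideal.span_mono ?_)
  · rw [← Ideal.span_mul_span', hP, hQ]; simp
  · rintro _ ⟨_, ⟨f, p, rfl⟩, _, ⟨g, q, rfl⟩, rfl⟩
    exact ⟨TensorProduct.dualDistrib R P Q (f ⊗ₜ g), p ⊗ₜ q, rfl⟩

theorem IsProgenerator.tensor (hP : IsProgenerator R P) (hQ : IsProgenerator R Q) :
    IsProgenerator R (P ⊗[R] Q) := by
  have := hP.finite
  have := hP.projective
  have := hQ.finite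
  have := hQ.projective
  exact ⟨inferInstance, inferInstance, hP.generator.tensor hQ.generator⟩

theorem isProgenerator_of_isAzumaya (A : Type*) [Ring A] [Algebra R A] [h : IsAzumaya R A] :
    IsProgenerator R A :=
  ⟨inferInstance, inferInstance, .of_faithful⟩

theorem endTensorEnd_bijective [Module.Finite R P] [Module.Projective R P]
    [Module.Finite R Q] [Module.Projective R Q] :
    Function.Bijective (Module.endTensorEndAlgHom (R := R) (S := R) (A := R) (M := P) (N := Q)) := by
  obtain ⟨k, m, f, hm⟩ := exists_dual_basis R P
  obtain ⟨l, n, g, hn⟩ := exists_dual_basis R Q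
  let c : Fin k → Fin l → (P ⊗[R] Q →ₗ[R] Module.End R P ⊗[R] Module.End R Q) := fun i j =>
    TensorProduct.map (LinearMap.smulRightₗ (f i)) (LinearMap.smulRightₗ (g j))
  let inv : Module.End R (P ⊗[R] Q) →ₗ[R] Module.End R P ⊗[R] Module.End R Q :=
    ∑ i, ∑ j, (c i j).comp (LinearMap.applyₗ (m i ⊗ₜ n j))
  have hP : ∀ φ : Module.End R P, ∑ i, LinearMap.smulRight (f i) (φ (m i)) = φ := fun φ => by
    ext x
    conv_rhs => rw [← hm x]
    simp [map_sum]
  have hQ : ∀ φ : Module.End R Q, ∑ i, LinearMap.smulRight (g i) (φ (n i)) = φ := fun φ => by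
    ext x
    conv_rhs => rw [← hn x]
    simp [map_sum]
  refine Function.bijective_iff_has_inverse.2 ⟨inv, fun x => ?_, fun h => ?_⟩
  · induction x with
    | zero => simp
    | add x y hx hy => rw [map_add, map_add, hx, hy]
    | tmul φ ψ =>
      conv_rhs => rw [← hP φ, ← hQ ψ, TensorProduct.sum_tmul]
      simp only [TensorProduct.tmul_sum]
      simp [inv, c, Module.endTensorEndAlgHom_apply, LinearMap.smulRightₗ]
  · refine TensorProduct.ext' fun x y => ?_
    conv_rhs => rw [← hm x, ← hn y, TensorProduct.sum_tmul]
    simp only [TensorProduct.tmul_sum]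
    have hc : ∀ i j z, Module.endTensorEndAlgHom (R := R) (S := R) (A := R) (c i j z) (x ⊗ₜ[R] y) =
        (f i x * g j y) • z := fun i j z => by
      induction z with
      | zero => simp
      | add a b ha hb => rw [map_add, map_add, LinearMap.add_apply, ha, hb, smul_add]
      | tmul a b =>
        simp [c, Module.endTensorEndAlgHom_apply, LinearMap.smulRightₗ]
        rw [← TensorProduct.smul_tmul', smul_smul, mul_comm]
    simp only [inv, LinearMap.sum_apply, LinearMap.comp_apply, map_sum, hc,
      TensorProduct.smul_tmul_smul, map_smul, LinearMap.applyₗ_apply_apply]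

theorem isAzumaya_tensor (A B : Type*) [Ring A] [Ring B] [Algebra R A] [Algebra R B]
    [hA : IsAzumaya R A] [hB : IsAzumaya R B] : IsAzumaya R (A ⊗[R] B) := by
  have hf : Function.Injective (algebraMap R (A ⊗[R] B)) := by
    have h1 : Function.Injective (Algebra.TensorProduct.includeLeft : A →ₐ[R] A ⊗[R] B) :=
      Algebra.TensorProduct.includeLeft_injective (FaithfulSMul.algebraMap_injective R B)
    have h2 := h1.comp (FaithfulSMul.algebraMap_injective R A)
    exact h2
  have : FaithfulSMul R (A ⊗[R] B) := (faithfulSMul_iff_algebraMap_injective _ _).2 hf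
  refine ⟨?_⟩
  let e : ((A ⊗[R] B) ⊗[R] (A ⊗[R] B)ᵐᵒᵖ) ≃ₐ[R] ((A ⊗[R] Aᵐᵒᵖ) ⊗[R] (B ⊗[R] Bᵐᵒᵖ)) :=
    (Algebra.TensorProduct.congr AlgEquiv.refl (Algebra.TensorProduct.opAlgEquiv R R A B).symm).trans
      (Algebra.TensorProduct.tensorTensorTensorComm R R R R A B Aᵐᵒᵖ Bᵐᵒᵖ)
  let d : ((A ⊗[R] Aᵐᵒᵖ) ⊗[R] (B ⊗[R] Bᵐᵒᵖ)) ≃ₐ[R] (Module.End R A ⊗[R] Module.End R B) :=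
    Algebra.TensorProduct.congr (AlgEquiv.ofBijective _ hA.bij) (AlgEquiv.ofBijective _ hB.bij)
  have key : AlgHom.mulLeftRight R (A ⊗[R] B) =
      (Module.endTensorEndAlgHom (R := R) (S := R) (A := R) (M := A) (N := B)).comp
        (d.toAlgHom.comp e.toAlgHom) := by
    apply AlgHom.toLinearMap_injective
    apply TensorProduct.ext
    apply TensorProduct.ext'
    intro a b
    apply LinearMap.ext
    intro x
    induction x using MulOpposite.rec' with
    | _ x =>
    induction x with
    | zero => simp
    | add x y hx hy => rw [MulOpposite.op_add, map_add, map_add, hx, hy]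
    | tmul a' b' =>
      apply TensorProduct.ext'
      intro x y
      simp [e, d, Module.endTensorEndAlgHom_apply]
  rw [key]
  exact endTensorEnd_bijective.comp (d.bijective.comp e.bijective)

theorem isAzumaya_op (A : Type*) [Ring A] [Algebra R A] [hA : IsAzumaya R A] :
    IsAzumaya R Aᵐᵒᵖ := by
  have : Module.Finite R Aᵐᵒᵖ := .equiv (MulOpposite.opLinearEquiv R)
  have : Module.Projective R Aᵐᵒᵖ := .of_equiv (MulOpposite.opLinearEquiv R)
  have : FaithfulSMul R Aᵐᵒᵖ :=
    .of_injective (MulOpposite.opLinearEquiv R : A ≃ₗ[R] Aᵐᵒᵖ) (LinearEquiv.injective _)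
  refine ⟨?_⟩
  let e : (Aᵐᵒᵖ ⊗[R] Aᵐᵒᵖᵐᵒᵖ) ≃ₐ[R] (A ⊗[R] Aᵐᵒᵖ) :=
    (Algebra.TensorProduct.congr AlgEquiv.refl (AlgEquiv.opOp R A).symm).trans
      (Algebra.TensorProduct.comm R Aᵐᵒᵖ A)
  let d : Module.End R A ≃ₐ[R] Module.End R Aᵐᵒᵖ :=
    (MulOpposite.opLinearEquiv R : A ≃ₗ[R] Aᵐᵒᵖ).conjAlgEquiv R
  have key : AlgHom.mulLeftRight R Aᵐᵒᵖ =
      d.toAlgHom.comp ((AlgHom.mulLeftRight R A).comp e.toAlgHom) := by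
    apply AlgHom.toLinearMap_injective
    apply TensorProduct.ext'
    intro a b
    ext x
    simp [e, d, LinearEquiv.conjAlgEquiv, mul_assoc]
  rw [key]
  exact d.bijective.comp (hA.bij.comp e.bijective)

end Modules

/-! ### Algebras and modules with a compatible group action

Group actions are written on the left; the right action in exponential notation is
`a ^ g = g⁻¹ • a`. -/

section Semilinear

variable {G R : Type*} [Group G] [CommRing R] [MulSemiringAction G R]
variable (M N : Type*) [AddCommGroup M] [Module R M] [DistribMulAction G M]
  [SMulDistribClass G R M] [AddCommGroup N] [Module R N] [DistribMulAction G N]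
  [SMulDistribClass G R N]

/-- The action of `g` on a module with compatible action, as a semilinear map. -/
def smulSemilinear (g : G) : M →ₛₗ[MulSemiringAction.toRingHom G R g] M where
  toFun m := g • m
  map_add' := smul_add g
  map_smul' r m := smul_distrib_smul g r m

@[simp]
theorem smulSemilinear_apply (g : G) (m : M) : smulSemilinear (R := R) M g m = g • m := rfl

/-- The diagonal action on a tensor product: `g • (m ⊗ n) = (g • m) ⊗ (g • n)`. -/
@[reducible]
def tensorAction : DistribMulAction G (M ⊗[R] N) where
  smul g := TensorProduct.map (smulSemilinear (R := R) M g) (smulSemilinear (R := R) N g)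
  one_smul x := by
    change TensorProduct.map (smulSemilinear (R := R) M 1) (smulSemilinear (R := R) N 1) x = x
    induction x with
    | zero => simp
    | add x y hx hy => rw [map_add, hx, hy]
    | tmul m n => simp
  mul_smul g h x := by
    change TensorProduct.map (smulSemilinear (R := R) M _) (smulSemilinear (R := R) N _) x =
      TensorProduct.map (smulSemilinear (R := R) M g) (smulSemilinear (R := R) N g)
        (TensorProduct.map (smulSemilinear (R := R) M h) (smulSemilinear (R := R) N h) x)
    induction x with
    | zero => simp
    | add x y hx hy => rw [map_add, map_add, map_add, hx, hy]
    | tmul m n => simp [mul_smul]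
  smul_zero g := map_zero (TensorProduct.map (smulSemilinear (R := R) M g) _)
  smul_add g := map_add (TensorProduct.map (smulSemilinear (R := R) M g) _)

theorem tensorAction_compat :
    letI := tensorAction (G := G) (R := R) M N
    SMulDistribClass G R (M ⊗[R] N) :=
  letI := tensorAction (G := G) (R := R) M N
  ⟨fun g r x =>
    (TensorProduct.map (smulSemilinear (R := R) M g) (smulSemilinear (R := R) N g)).map_smulₛₗ r x⟩

end Semilinear

variable (G : Type v) (R : Type u) [Group G] [CommRing R] [MulSemiringAction G R]

/-- A `G`-algebra over the commutative `G`-ring `R`: an `R`-algebra on which `G` acts by ring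
automorphisms such that `g • (r • a) = (g • r) • (g • a)`. -/
structure GAlgebra where
  carrier : Type w
  [ring : Ring carrier]
  [algebra : Algebra R carrier]
  [action : MulSemiringAction G carrier]
  [compat : SMulDistribClass G R carrier]

/-- An `R`-module with compatible `G`-action (that is, a module over the skew group ring):
`g • (r • p) = (g • r) • (g • p)`. -/
structure GModule where
  carrier : Type w
  [addCommGroup : AddCommGroup carrier]
  [module : Module R carrier]
  [action : DistribMulAction G carrier]
  [compat : SMulDistribClass G R carrier]

attribute [instance] GAlgebra.ring GAlgebra.algebra GAlgebra.action GAlgebra.compat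
attribute [instance] GModule.addCommGroup GModule.module GModule.action GModule.compat

variable {G R}

namespace GAlgebra

/-- Isomorphisms of `G`-algebras over `R`. -/
structure Iso (A B : GAlgebra.{u, v, w} G R) where
  toAlgEquiv : A.carrier ≃ₐ[R] B.carrier
  map_smul : ∀ (g : G) (a : A.carrier), toAlgEquiv (g • a) = g • toAlgEquiv a

/-- The tensor product `A ⊗[R] B` with the diagonal action of `G`. -/
def tensor (A B : GAlgebra.{u, v, w} G R) : GAlgebra.{u, v, w} G R :=
  letI act := tensorAction (G := G) (R := R) A.carrier B.carrier
  { carrier := A.carrier ⊗[R] B.carrier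
    action :=
      { act with
        smul_one := fun g => by
          change TensorProduct.map (smulSemilinear (R := R) A.carrier g)
            (smulSemilinear (R := R) B.carrier g) (1 ⊗ₜ 1) = 1 ⊗ₜ 1
          simp
        smul_mul := fun g x y => by
          change TensorProduct.map (smulSemilinear (R := R) A.carrier g)
              (smulSemilinear (R := R) B.carrier g) (x * y) =
            TensorProduct.map (smulSemilinear (R := R) A.carrier g)
                (smulSemilinear (R := R) B.carrier g) x *
              TensorProduct.map (smulSemilinear (R := R) A.carrier g)
                (smulSemilinear (R := R) B.carrier g) y
          induction x with
          | zero => simp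
          | add x x' hx hx' => rw [add_mul, map_add, map_add, hx, hx', add_mul]
          | tmul a b =>
            induction y with
            | zero => simp
            | add y y' hy hy' => rw [mul_add, map_add, map_add, hy, hy', mul_add]
            | tmul a' b' => simp [smul_mul'] }
    compat := tensorAction_compat A.carrier B.carrier }

/-- The opposite algebra with the same action of `G`. -/
def op (A : GAlgebra.{u, v, w} G R) : GAlgebra.{u, v, w} G R where
  carrier := A.carrierᵐᵒᵖ
  action :=
    { (inferInstance : DistribMulAction G A.carrierᵐᵒᵖ) with
      smul_one := fun g => MulOpposite.unop_injective (smul_one g)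
      smul_mul := fun g x y => MulOpposite.unop_injective (smul_mul' g y.unop x.unop) }
  compat := ⟨fun g r x => MulOpposite.unop_injective (smul_distrib_smul g r x.unop)⟩

/-- The ring `R` itself as a `G`-algebra (lifted to the universe of `G`). -/
def unit (G : Type v) (R : Type u) [Group G] [CommRing R] [MulSemiringAction G R] :
    GAlgebra.{u, v, max u v} G R where
  carrier := ULift.{v} R
  action :=
    { smul := fun g r => ⟨g • r.down⟩
      one_smul := fun r => ULift.ext _ _ (one_smul G r.down)
      mul_smul := fun g h r => ULift.ext _ _ (mul_smul g h r.down)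
      smul_zero := fun g => ULift.ext _ _ (smul_zero g)
      smul_add := fun g r s => ULift.ext _ _ (smul_add g r.down s.down)
      smul_one := fun g => ULift.ext _ _ (smul_one g)
      smul_mul := fun g r s => ULift.ext _ _ (smul_mul' g r.down s.down) }
  compat := ⟨fun g r s => ULift.ext _ _ (smul_mul' g r s.down)⟩

/-- The module with compatible action underlying a `G`-algebra. -/
def toGModule (A : GAlgebra.{u, v, w} G R) : GModule.{u, v, w} G R where
  carrier := A.carrier

end GAlgebra

namespace GModule

/-- The tensor product `P ⊗[R] Q` with the diagonal action of `G`. -/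
def tensor (P Q : GModule.{u, v, w} G R) : GModule.{u, v, w} G R :=
  letI act := tensorAction (G := G) (R := R) P.carrier Q.carrier
  { carrier := P.carrier ⊗[R] Q.carrier
    action := act
    compat := tensorAction_compat P.carrier Q.carrier }

/-- The action of `G` on `End_R P` by `(g • α) p = g • α (g⁻¹ • p)`. -/
@[reducible]
def endAction (P : GModule.{u, v, w} G R) : MulSemiringAction G (Module.End R P.carrier) where
  smul := fun g α =>
    { toFun := fun p => g • α (g⁻¹ • p)
      map_add' := fun p q => by simp
      map_smul' := fun r p => by simp [smul_distrib_smul] }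
  one_smul := fun α => LinearMap.ext fun p => by
    change (1 : G) • α ((1 : G)⁻¹ • p) = α p
    simp
  mul_smul := fun g h α => LinearMap.ext fun p => by
    change (g * h) • α ((g * h)⁻¹ • p) = g • h • α (h⁻¹ • g⁻¹ • p)
    simp [mul_smul]
  smul_zero := fun g => LinearMap.ext fun p => smul_zero g
  smul_add := fun g α β => LinearMap.ext fun p => smul_add g _ _
  smul_one := fun g => LinearMap.ext fun p => smul_inv_smul g p
  smul_mul := fun g α β => LinearMap.ext fun p => by
    change g • α (β (g⁻¹ • p)) = g • α (g⁻¹ • g • β (g⁻¹ • p))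
    simp

/-- The `G`-algebra `End_R P`, with `(g • α) p = g • α (g⁻¹ • p)`. -/
def endAlgebra (P : GModule.{u, v, w} G R) : GAlgebra.{u, v, w} G R :=
  letI := P.endAction
  { carrier := Module.End R P.carrier
    compat := ⟨fun g r α => LinearMap.ext fun p => smul_distrib_smul g r (α (g⁻¹ • p))⟩ }

end GModule

namespace GAlgebra

/-- Two `G`-algebras `A` and `B` over `R` are equivalent if `A ⊗ End_R P ≅ B ⊗ End_R Q` as
`G`-algebras for some modules `P`, `Q` with compatible `G`-action that are progenerators over
`R`. -/
def Equivalent (A B : GAlgebra.{u, v, max u v} G R) : Prop :=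
  ∃ P Q : GModule.{u, v, max u v} G R, IsProgenerator R P.carrier ∧ IsProgenerator R Q.carrier ∧
    Nonempty (Iso (A.tensor P.endAlgebra) (B.tensor Q.endAlgebra))

namespace Iso

variable {A B C D : GAlgebra.{u, v, w} G R}

def refl (A : GAlgebra.{u, v, w} G R) : Iso A A := ⟨AlgEquiv.refl, fun _ _ => rfl⟩

def symm (e : Iso A B) : Iso B A :=
  ⟨e.toAlgEquiv.symm, fun g b => e.toAlgEquiv.injective (by simp [e.map_smul])⟩

def trans (e : Iso A B) (f : Iso B C) : Iso A C :=
  ⟨e.toAlgEquiv.trans f.toAlgEquiv, fun g a => by simp [e.map_smul, f.map_smul]⟩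

end Iso

section

variable {X Y Z W V : Type*} [AddCommGroup X] [AddCommGroup Y] [AddCommGroup Z] [AddCommGroup W]
  [AddCommGroup V] [Module R X] [Module R Y] [Module R Z] [Module R W]

theorem addHom_ext₂ {f g : X ⊗[R] Y →+ V} (h : ∀ x y, f (x ⊗ₜ y) = g (x ⊗ₜ y)) : f = g := by
  ext t
  induction t with
  | zero => simp
  | add a b ha hb => rw [map_add, map_add, ha, hb]
  | tmul x y => exact h x y

theorem addHom_ext₃ {f g : (X ⊗[R] Y) ⊗[R] Z →+ V}
    (h : ∀ x y z, f ((x ⊗ₜ y) ⊗ₜ z) = g ((x ⊗ₜ y) ⊗ₜ z)) : f = g := by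
  refine addHom_ext₂ fun t z => ?_
  induction t with
  | zero => simp
  | add a b ha hb => rw [TensorProduct.add_tmul, map_add, map_add, ha, hb]
  | tmul x y => exact h x y z

theorem addHom_ext₄ {f g : (X ⊗[R] Y) ⊗[R] (Z ⊗[R] W) →+ V}
    (h : ∀ x y z w, f ((x ⊗ₜ y) ⊗ₜ (z ⊗ₜ w)) = g ((x ⊗ₜ y) ⊗ₜ (z ⊗ₜ w))) : f = g := by
  refine addHom_ext₂ fun t s => ?_
  induction s with
  | zero => simp
  | add a b ha hb => rw [TensorProduct.tmul_add, map_add, map_add, ha, hb]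
  | tmul z w =>
    induction t with
    | zero => simp
    | add a b ha hb => rw [TensorProduct.add_tmul, map_add, map_add, ha, hb]
    | tmul x y => exact h x y z w

end

/-- The action of `g` on `A` as an additive map. -/
def act (A : GAlgebra.{u, v, w} G R) (g : G) : A.carrier →+ A.carrier :=
  DistribSMul.toAddMonoidHom A.carrier g

namespace Iso

/-- An algebra isomorphism that commutes with the action of each `g` is an isomorphism of
`G`-algebras. -/
def ofComp {A B : GAlgebra.{u, v, w} G R} (e : A.carrier ≃ₐ[R] B.carrier)
    (h : ∀ g, (e : A.carrier →+ B.carrier).comp (A.act g) =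
      (B.act g).comp (e : A.carrier →+ B.carrier)) : Iso A B :=
  ⟨e, fun g a => DFunLike.congr_fun (h g) a⟩

variable {A B C D : GAlgebra.{u, v, w} G R}

def comm (A B : GAlgebra.{u, v, w} G R) : Iso (A.tensor B) (B.tensor A) :=
  ofComp (Algebra.TensorProduct.comm R A.carrier B.carrier)
    fun _ => addHom_ext₂ fun _ _ => rfl

def assoc (A B C : GAlgebra.{u, v, w} G R) :
    Iso ((A.tensor B).tensor C) (A.tensor (B.tensor C)) :=
  ofComp (Algebra.TensorProduct.assoc R R R A.carrier B.carrier C.carrier)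
    fun _ => addHom_ext₃ fun _ _ _ => rfl

def tensorComm (A B C D : GAlgebra.{u, v, w} G R) :
    Iso ((A.tensor B).tensor (C.tensor D)) ((A.tensor C).tensor (B.tensor D)) :=
  ofComp (Algebra.TensorProduct.tensorTensorTensorComm R R R R
      A.carrier B.carrier C.carrier D.carrier)
    fun _ => addHom_ext₄ fun _ _ _ _ => rfl

def congr (e : Iso A B) (f : Iso C D) : Iso (A.tensor C) (B.tensor D) :=
  ofComp (Algebra.TensorProduct.congr e.toAlgEquiv f.toAlgEquiv)
    fun g => addHom_ext₂ fun a c =>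
      congrArg₂ (fun x y => x ⊗ₜ[R] y) (e.map_smul g a) (f.map_smul g c)

def unitTensor (A : GAlgebra.{u, v, max u v} G R) : Iso ((unit G R).tensor A) A :=
  let e : ULift.{v} R ⊗[R] A.carrier ≃ₐ[R] A.carrier :=
    (Algebra.TensorProduct.congr ULift.algEquiv AlgEquiv.refl).trans
      (Algebra.TensorProduct.lid R A.carrier)
  ofComp (A := (unit G R).tensor A) e
    fun g => addHom_ext₂ fun r a => (smul_distrib_smul g r.down a).symm

noncomputable def endTensor (P Q : GModule.{u, v, w} G R) (hP : IsProgenerator R P.carrier)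
    (hQ : IsProgenerator R Q.carrier) :
    Iso (P.endAlgebra.tensor Q.endAlgebra) (P.tensor Q).endAlgebra :=
  ofComp (A := P.endAlgebra.tensor Q.endAlgebra) (B := (P.tensor Q).endAlgebra)
    (haveI := hP.finite
     haveI := hP.projective
     haveI := hQ.finite
     haveI := hQ.projective
     AlgEquiv.ofBijective (Module.endTensorEndAlgHom (R := R) (S := R) (A := R)
      (M := P.carrier) (N := Q.carrier)) endTensorEnd_bijective)
    fun _ => addHom_ext₂ fun _ _ => TensorProduct.ext' fun _ _ => rfl

noncomputable def tensorOp (A : GAlgebra.{u, v, w} G R) (hA : IsAzumaya R A.carrier) :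
    Iso (A.tensor A.op) A.toGModule.endAlgebra :=
  ofComp (A := A.tensor A.op) (B := A.toGModule.endAlgebra)
    (AlgEquiv.ofBijective (AlgHom.mulLeftRight R A.carrier) hA.bij)
    fun g => addHom_ext₂ fun a b => LinearMap.ext fun x => by
      have key (c x : A.carrier) :
          AlgHom.mulLeftRight R A.carrier ((g • a) ⊗ₜ MulOpposite.op (g • c)) x =
            g • AlgHom.mulLeftRight R A.carrier (a ⊗ₜ MulOpposite.op c) (g⁻¹ • x) := by
        simp only [AlgHom.mulLeftRight_apply, MulOpposite.unop_op, smul_mul', smul_inv_smul]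
      exact key (MulOpposite.unop b) x

end Iso

theorem isAzumaya_unit : IsAzumaya R (unit G R).carrier :=
  IsAzumaya.of_AlgEquiv R R (ULift.{v} R) ULift.algEquiv.symm

namespace Equivalent

variable {A B C D : GAlgebra.{u, v, max u v} G R}

theorem isProgenerator_unit : IsProgenerator R (unit G R).toGModule.carrier :=
  haveI := isAzumaya_unit (G := G) (R := R)
  isProgenerator_of_isAzumaya (R := R) (unit G R).carrier

theorem of_iso (e : Iso A B) : Equivalent A B :=
  ⟨_, _, isProgenerator_unit, isProgenerator_unit, ⟨e.congr (Iso.refl _)⟩⟩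

theorem symm : Equivalent A B → Equivalent B A := fun ⟨P, Q, hP, hQ, ⟨e⟩⟩ =>
  ⟨Q, P, hQ, hP, ⟨e.symm⟩⟩

theorem trans : Equivalent A B → Equivalent B C → Equivalent A C :=
  fun ⟨P, Q, hP, hQ, ⟨e⟩⟩ ⟨P', Q', hP', hQ', ⟨f⟩⟩ =>
  ⟨P.tensor P', Q'.tensor Q, hP.tensor hP', hQ'.tensor hQ,
    ⟨((Iso.refl A).congr (Iso.endTensor P P' hP hP').symm).trans <|
      (Iso.assoc _ _ _).symm.trans <| (e.congr (Iso.refl _)).trans <|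
      (Iso.assoc _ _ _).trans <| ((Iso.refl B).congr (Iso.comm _ _)).trans <|
      (Iso.assoc _ _ _).symm.trans <| (f.congr (Iso.refl _)).trans <|
      (Iso.assoc _ _ _).trans <| (Iso.refl C).congr (Iso.endTensor Q' Q hQ' hQ)⟩⟩

theorem tensor : Equivalent A B → Equivalent C D → Equivalent (A.tensor C) (B.tensor D) :=
  fun ⟨P, Q, hP, hQ, ⟨e⟩⟩ ⟨P', Q', hP', hQ', ⟨f⟩⟩ =>
  ⟨P.tensor P', Q.tensor Q', hP.tensor hP', hQ.tensor hQ',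
    ⟨((Iso.refl _).congr (Iso.endTensor P P' hP hP').symm).trans <|
      (Iso.tensorComm _ _ _ _).trans <| (e.congr f).trans <|
      (Iso.tensorComm _ _ _ _).trans <| (Iso.refl _).congr (Iso.endTensor Q Q' hQ hQ')⟩⟩

/-- Trivial `G`-algebras are equivalent to `R`. -/
theorem end_unit (P : GModule.{u, v, max u v} G R) (hP : IsProgenerator R P.carrier) :
    Equivalent P.endAlgebra (unit G R) :=
  ⟨_, P.tensor (unit G R).toGModule, isProgenerator_unit, hP.tensor isProgenerator_unit,
    ⟨(Iso.endTensor P _ hP isProgenerator_unit).trans (Iso.unitTensor _).symm⟩⟩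

end Equivalent

end GAlgebra

/-! ### The Brauer-Clifford group -/

section

variable (G R)

/-- Azumaya `G`-algebras over `R`. -/
def AzumayaGAlgebra : Type (max (u + 1) (v + 1)) :=
  {A : GAlgebra.{u, v, max u v} G R // IsAzumaya R A.carrier}

/-- Equivalence of Azumaya `G`-algebras. -/
instance AzumayaGAlgebra.setoid : Setoid (AzumayaGAlgebra G R) where
  r A B := GAlgebra.Equivalent A.1 B.1
  iseqv := ⟨fun _ => .of_iso (.refl _), .symm, .trans⟩

/-- The Brauer-Clifford group: equivalence classes of Azumaya `G`-algebras over `R`. -/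
def BrCliff : Type (max (u + 1) (v + 1)) := Quotient (AzumayaGAlgebra.setoid G R)

end

/-- The class in the Brauer-Clifford group of an Azumaya `G`-algebra. -/
def BrCliff.mk (A : GAlgebra.{u, v, max u v} G R) (hA : IsAzumaya R A.carrier) : BrCliff G R :=
  Quotient.mk (AzumayaGAlgebra.setoid G R) ⟨A, hA⟩

namespace BrCliff

/-- The multiplication of `BrCliff G R` is induced by the tensor product. -/
instance : Mul (BrCliff G R) where
  mul := Quotient.map₂
    (fun A B => ⟨A.1.tensor B.1,
      haveI := A.2; haveI := B.2; isAzumaya_tensor (R := R) A.1.carrier B.1.carrier⟩)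
    fun _ _ h _ _ h' => h.tensor h'

instance : One (BrCliff G R) where
  one := mk (GAlgebra.unit G R) GAlgebra.isAzumaya_unit

instance : CommMonoid (BrCliff G R) where
  mul_assoc a b c := by
    induction a using Quotient.inductionOn
    induction b using Quotient.inductionOn
    induction c using Quotient.inductionOn
    exact Quotient.sound (.of_iso (.assoc _ _ _))
  mul_comm a b := by
    induction a using Quotient.inductionOn
    induction b using Quotient.inductionOn
    exact Quotient.sound (.of_iso (.comm _ _))
  one_mul a := by
    induction a using Quotient.inductionOn
    exact Quotient.sound (.of_iso (.unitTensor _))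
  mul_one a := by
    induction a using Quotient.inductionOn
    exact Quotient.sound (.of_iso ((GAlgebra.Iso.comm _ _).trans (.unitTensor _)))

theorem mk_mul_mk_op (A : GAlgebra.{u, v, max u v} G R) (hA : IsAzumaya R A.carrier)
    (hA' : IsAzumaya R A.op.carrier) : mk A hA * mk A.op hA' = 1 :=
  Quotient.sound (.trans (.of_iso (.tensorOp A hA))
    (.end_unit _ (isProgenerator_of_isAzumaya (R := R) A.carrier)))

/-- Inverses in `BrCliff G R` are given by opposite algebras. -/
instance : Inv (BrCliff G R) where
  inv := Quotient.map (fun A => ⟨A.1.op, haveI := A.2; isAzumaya_op (R := R) A.1.carrier⟩)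
    fun A B h => by
      refine Quotient.exact (s := AzumayaGAlgebra.setoid G R) ?_
      have hA := A.2
      have hB := B.2
      have h' : mk A.1 A.2 = mk B.1 B.2 := Quotient.sound h
      have h1 := mk_mul_mk_op A.1 A.2 (isAzumaya_op (R := R) A.1.carrier)
      have h2 := mk_mul_mk_op B.1 B.2 (isAzumaya_op (R := R) B.1.carrier)
      rw [h'] at h1
      exact (left_inv_eq_right_inv (M := BrCliff G R) ((mul_comm _ _).trans h1) h2)

instance : CommGroup (BrCliff G R) where
  inv_mul_cancel a := by
    induction a using Quotient.inductionOn with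
    | h A => exact (mul_comm _ _).trans (mk_mul_mk_op A.1 A.2 _)

end BrCliff

/-! ### Tensor induction (corestriction) of `H`-algebras -/

section TensorInduction

open PiTensorProduct

variable (H : Subgroup G) (A : GAlgebra.{u, v, w} H R)

/-- The underlying ring of `Component`. -/
def componentSubring (ω : G ⧸ H) : Subring ({x : G // (x : G ⧸ H) = ω} → A.carrier) where
  carrier := {f | ∀ (x y : {x : G // (x : G ⧸ H) = ω}) (h : H), y.1 = x.1 * h → f y = h⁻¹ • f x}
  mul_mem' hf hg x y h e := by simp [hf x y h e, hg x y h e, smul_mul']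
  one_mem' x y h e := by simp
  add_mem' hf hg x y h e := by simp [hf x y h e, hg x y h e]
  zero_mem' x y h e := by simp
  neg_mem' hf x y h e := by simp [hf x y h e]

/-- The component `A_ω = g ⊗ A`, for a coset `ω = gH`, of the induced module `RG ⊗_{RH} A`.
An element `g ⊗ a = gh ⊗ h⁻¹a` is represented by the function on the coset `ω` that sends each
representative `x ∈ ω` to the unique `b` with `g ⊗ a = x ⊗ b`; so the elements are the functions
`f : ω → A` with `f (x * h) = h⁻¹ • f x` for `h ∈ H`. Addition and multiplication are pointwise,
that is, `(x ⊗ a) (x ⊗ b) = x ⊗ (a b)`. -/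
def Component (ω : G ⧸ H) : Type (max v w) := componentSubring H A ω

namespace Component

variable {H A} {ω ω' : G ⧸ H}

instance : Ring (Component H A ω) := inferInstanceAs (Ring (componentSubring H A ω))

theorem ext {f g : Component H A ω} (h : ∀ x, f.1 x = g.1 x) : f = g := Subtype.ext (funext h)

/-- The `R`-algebra structure of `A_ω`: since `r (x ⊗ a) = x ⊗ ((x⁻¹ • r) a)`, the scalar `r`
acts on values at `x` by `x⁻¹ • r`. -/
instance : Algebra R (Component H A ω) :=
  RingHom.toAlgebra'
    { toFun := fun r => ⟨fun x => algebraMap R A.carrier (x.1⁻¹ • r), fun x y h e => by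
        change algebraMap R A.carrier (y.1⁻¹ • r) = h⁻¹ • algebraMap R A.carrier (x.1⁻¹ • r)
        rw [e, mul_inv_rev, mul_smul, ← algebraMap.smul']
        rfl⟩
      map_one' := ext fun x => by
        change algebraMap R A.carrier _ = 1
        simp
      map_mul' := fun r s => ext fun x => by
        change algebraMap R A.carrier _ = algebraMap R A.carrier _ * algebraMap R A.carrier _
        simp [smul_mul']
      map_zero' := ext fun x => by
        change algebraMap R A.carrier _ = 0
        simp
      map_add' := fun r s => ext fun x => by
        change algebraMap R A.carrier _ = algebraMap R A.carrier _ + algebraMap R A.carrier _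
        simp }
    fun r f => ext fun x => Algebra.commutes (x.1⁻¹ • r) (f.1 x)

theorem smul_val (r : R) (f : Component H A ω) (x : {x : G // (x : G ⧸ H) = ω}) :
    (r • f).1 x = (x.1⁻¹ • r) • f.1 x :=
  (Algebra.smul_def (x.1⁻¹ • r) (f.1 x)).symm

/-- Left multiplication by `g` on the induced module, `x ⊗ a ↦ g x ⊗ a`, as a map from `A_ω'` to
`A_ω` where `ω = g ω'`. -/
def translate (g : G) (e : g • ω' = ω) : Component H A ω' →+* Component H A ω where
  toFun f := ⟨fun x => f.1 ⟨g⁻¹ * x.1, by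
      have : ω' = g⁻¹ • ω := by rw [← e, inv_smul_smul]
      exact (congrArg (g⁻¹ • ·) x.2).trans this.symm⟩, fun x y h hy => f.2 _ _ h (by simp [hy, mul_assoc])⟩
  map_one' := rfl
  map_mul' _ _ := rfl
  map_zero' := rfl
  map_add' _ _ := rfl

theorem translate_smul (g : G) (e : g • ω' = ω) (r : R) (f : Component H A ω') :
    translate g e (r • f) = (g • r) • translate g e f := ext fun x => by
  rw [smul_val]
  change (r • f).1 _ = _ • f.1 _
  rw [smul_val]
  simp [mul_smul]

end Component

/-- The action of `g` on a family `(a_ω)`: the new component at `ω` is `g a_{g⁻¹ω}`. -/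
def translateFamily (g : G) (a : ∀ ω, Component H A ω) (ω : G ⧸ H) : Component H A ω :=
  Component.translate g (smul_inv_smul g ω) (a (g⁻¹ • ω))

variable {H A}

theorem translateFamily_update [DecidableEq (G ⧸ H)] (g : G) (a : ∀ ω, Component H A ω)
    (i : G ⧸ H) (m : Component H A i) :
    translateFamily H A g (Function.update a i m) =
      Function.update (translateFamily H A g a) (g • i) (Component.translate g rfl m) := by
  funext ω
  by_cases h : ω = g • i
  · subst h
    rw [Function.update_self]
    have : ∀ (ω' : G ⧸ H) (e : g • ω' = g • i) (_ : ω' = i),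
        Component.translate g e (Function.update a i m ω') = Component.translate g rfl m := by
      rintro _ e rfl
      rw [Function.update_self]
    exact this _ _ (inv_smul_smul g i)
  · rw [Function.update_of_ne h]
    have : g⁻¹ • ω ≠ i := fun h' => h (inv_smul_eq_iff.1 h')
    rw [translateFamily, translateFamily, Function.update_of_ne this]

theorem translateFamily_apply_self (g : G) (a : ∀ ω, Component H A ω) (i : G ⧸ H) :
    translateFamily H A g a (g • i) = Component.translate g rfl (a i) := by
  have : ∀ (ω' : G ⧸ H) (e : g • ω' = g • i) (_ : ω' = i),
      Component.translate g e (a ω') = Component.translate g rfl (a i) := by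
    rintro _ e rfl
    rfl
  exact this _ _ (inv_smul_smul g i)

theorem translateFamily_one (a : ∀ ω, Component H A ω) : translateFamily H A 1 a = a := by
  have : ∀ (ω ω' : G ⧸ H) (e : (1 : G) • ω' = ω) (_ : ω' = ω),
      Component.translate 1 e (a ω') = a ω := by
    rintro ω _ e rfl
    exact Component.ext fun x => congrArg (a _).1 (Subtype.ext (by simp))
  exact funext fun ω => this _ _ _ (by simp)

theorem translateFamily_mul (g h : G) (a : ∀ ω, Component H A ω) :
    translateFamily H A (g * h) a = translateFamily H A g (translateFamily H A h a) := by
  have : ∀ (ω ω' ω'' : G ⧸ H) (e : (g * h) • ω' = ω) (e' : g • h • ω'' = ω) (_ : ω' = ω''),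
      Component.translate (g * h) e (a ω') =
        Component.translate g e' (Component.translate h rfl (a ω'')) := by
    rintro ω ω' _ e e' rfl
    exact Component.ext fun x => congrArg (a _).1 (Subtype.ext (by simp [mul_assoc]))
  funext ω
  obtain ⟨η, rfl⟩ : ∃ η, g • h • η = ω := ⟨h⁻¹ • g⁻¹ • ω, by simp⟩
  rw [translateFamily_apply_self, translateFamily_apply_self]
  exact this _ _ _ _ rfl (by simp [mul_smul])

/-- The action of `g` on `⨂ A_ω`: `g • (r ⨂ a_ω) = (g • r) ⨂ (g a_{g⁻¹ω})`. -/
noncomputable def tensorInductionAct (g : G) :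
    (⨂[R] ω : G ⧸ H, Component H A ω) →+ ⨂[R] ω : G ⧸ H, Component H A ω := by
  classical
  exact liftAddHom (fun p => (g • p.1) • tprod R (translateFamily H A g p.2))
    (fun r a i h => by
      have h0 : translateFamily H A g a (g • i) = 0 := by
        rw [translateFamily_apply_self, h, map_zero]
      exact (congrArg _ ((PiTensorProduct.tprod R).map_coord_zero (g • i) h0)).trans (smul_zero _))
    (fun a => by simp)
    (fun {_} r a i m₁ m₂ => by
      simp only [translateFamily_update, map_add, MultilinearMap.map_update_add, smul_add])
    (fun r r' a => by simp [add_smul])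
    (fun {_} r a i r' => by
      simp only [translateFamily_update, Component.translate_smul, MultilinearMap.map_update_smul]
      rw [← translateFamily_apply_self, Function.update_eq_self, smul_smul, smul_mul', mul_comm])

theorem tensorInductionAct_smul_tprod (g : G) (r : R) (a : ∀ ω, Component H A ω) :
    tensorInductionAct g (r • tprod R a) = (g • r) • tprod R (translateFamily H A g a) := by
  rw [← tprodCoeff_eq_smul_tprod]
  rfl

variable (H A)

/-- The tensor induced `G`-algebra `A^{⊗G} = ⨂_{ω ∈ G/H} A_ω` (tensor product over `R`) of an
`H`-algebra `A`, with `g • ⨂ a_ω = ⨂ (g a_{g⁻¹ω})`. -/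
noncomputable def tensorInduction : GAlgebra.{u, v, max u v w} G R where
  carrier := ⨂[R] ω : G ⧸ H, Component H A ω
  action :=
    { smul := fun g => tensorInductionAct g
      one_smul := fun x => by
        change tensorInductionAct 1 x = x
        induction x using PiTensorProduct.induction_on with
        | smul_tprod r a => rw [tensorInductionAct_smul_tprod, translateFamily_one, one_smul]
        | add x y hx hy => rw [map_add, hx, hy]
      mul_smul := fun g h x => by
        change tensorInductionAct _ x = tensorInductionAct _ (tensorInductionAct _ x)
        induction x using PiTensorProduct.induction_on with
        | smul_tprod r a => simp only [tensorInductionAct_smul_tprod, translateFamily_mul, mul_smul]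
        | add x y hx hy => rw [map_add, map_add, map_add, hx, hy]
      smul_zero := fun g => map_zero (tensorInductionAct g)
      smul_add := fun g => map_add (tensorInductionAct g)
      smul_one := fun g => by
        change tensorInductionAct g 1 = 1
        have := tensorInductionAct_smul_tprod (R := R) (H := H) (A := A) g 1 1
        rw [one_smul, smul_one, one_smul] at this
        exact this
      smul_mul := fun g x y => by
        change tensorInductionAct g (x * y) = tensorInductionAct g x * tensorInductionAct g y
        induction x using PiTensorProduct.induction_on with
        | add x x' hx hx' => rw [add_mul, map_add, map_add, hx, hx', add_mul]
        | smul_tprod r a =>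
          induction y using PiTensorProduct.induction_on with
          | add y y' hy hy' => rw [mul_add, map_add, map_add, hy, hy', mul_add]
          | smul_tprod s b =>
            rw [smul_tprod_mul_smul_tprod, tensorInductionAct_smul_tprod,
              tensorInductionAct_smul_tprod, tensorInductionAct_smul_tprod,
              smul_tprod_mul_smul_tprod, smul_mul']
            rfl }
  compat := @SMulDistribClass.mk _ _ _ _ (_) _ fun g r x => by
    change tensorInductionAct g (r • x) = (g • r) • tensorInductionAct g x
    induction x using PiTensorProduct.induction_on with
    | smul_tprod s a =>
      rw [smul_smul, tensorInductionAct_smul_tprod, tensorInductionAct_smul_tprod, smul_smul,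
        smul_mul']
    | add x y hx hy => rw [smul_add, map_add, map_add, hx, hy, smul_add]

end TensorInduction

end BrauerClifford

/-!
Tensor induction is a tensor functor. The three facts needed about it are isomorphisms of
`G`-algebras `A^{⊗G} ≅ B^{⊗G}` for isomorphic `H`-algebras `A ≅ B`,
`A^{⊗G} ⊗ B^{⊗G} ≅ (A ⊗ B)^{⊗G}` and `(End P)^{⊗G} ≅ End (P^{⊗G})` for a progenerator `P`, where
`P^{⊗G} = ⨂ P_ω` is the tensor induced module, which is again a progenerator
(`GAlgebra.Iso.tensorInductionCongr`, `GAlgebra.Iso.tensorInductionTensor`,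
`GAlgebra.Iso.tensorInductionEnd`). Applied to an isomorphism `A ⊗ End P ≅ B ⊗ End Q` they give
`A^{⊗G} ⊗ End (P^{⊗G}) ≅ B^{⊗G} ⊗ End (Q^{⊗G})`, so `[A] ↦ [A^{⊗G}]` is well defined, and the
second one says that it is multiplicative. Uniqueness is clear because every element of the
Brauer-Clifford group is a class `[A]`.

Each isomorphism is assembled from two steps, both independent of the group action on `⨂`.

* At a single coset: evaluation at a representative `x ∈ ω` identifies `A_ω` with `A`, semilinearly
  with respect to the automorphism `r ↦ x⁻¹ r` of `R` (`Component.eval`, `ModuleComponent.eval`).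
  Hence the canonical maps `A_ω ⊗ B_ω → (A ⊗ B)_ω` and `(End P)_ω → End (P_ω)` are bijective, and
  `A_ω` is Azumaya, `P_ω` a progenerator, if `A`, `P` are.
* Over the finite index set `G ⧸ H`: the canonical maps `(⨂ A i) ⊗ (⨂ B i) → ⨂ (A i ⊗ B i)` and, for
  finitely generated projective modules, `⨂ End (P i) → End (⨂ P i)` are bijective
  (`tensorPiHom_bijective`, `endPiHom_bijective`). It follows that a finite tensor product of
  Azumaya algebras is Azumaya (`isAzumaya_piTensor`).

Equivariance has to be checked only on pure tensors, since these span over `R`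
(`GAlgebra.Iso.ofSpan`).
-/

namespace BrauerClifford

/-! ### Finite tensor products of modules and algebras -/

section PiTensor

open PiTensorProduct

variable {ι R : Type*} [CommRing R]

theorem submodule_span_range_tprod_eq_top {M : ι → Type*} [∀ i, AddCommGroup (M i)]
    [∀ i, Module R (M i)] :
    Submodule.span R (Set.range (tprod R : MultilinearMap R M _)) = ⊤ := by
  rw [eq_top_iff]
  rintro x -
  induction x using PiTensorProduct.induction_on with
  | smul_tprod r a => exact Submodule.smul_mem _ _ (Submodule.subset_span ⟨a, rfl⟩)
  | add x y hx hy => exact add_mem hx hy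

section Algebras

variable {A B : ι → Type*} [∀ i, Ring (A i)] [∀ i, Ring (B i)] [∀ i, Algebra R (A i)]
  [∀ i, Algebra R (B i)]

/-- The homomorphism `⨂ A i → ⨂ B i` induced by a family of algebra homomorphisms. -/
noncomputable def piTensorMap (f : ∀ i, A i →ₐ[R] B i) : (⨂[R] i, A i) →ₐ[R] ⨂[R] i, B i :=
  liftAlgHom ((PiTensorProduct.tprod R).compLinearMap fun i => (f i).toLinearMap)
    (by simp [one_def]; rfl)
    (fun x y => by simp; rfl)

@[simp]
theorem piTensorMap_tprod (f : ∀ i, A i →ₐ[R] B i) (a : ∀ i, A i) :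
    piTensorMap f (tprod R a) = tprod R fun i => f i (a i) :=
  lift.tprod a

/-- The isomorphism `⨂ A i ≅ ⨂ B i` induced by a family of algebra isomorphisms. -/
noncomputable def piTensorCongr (e : ∀ i, A i ≃ₐ[R] B i) :
    (⨂[R] i, A i) ≃ₐ[R] ⨂[R] i, B i :=
  AlgEquiv.ofLinearEquiv (PiTensorProduct.congr fun i => (e i).toLinearEquiv)
    (map_one (piTensorMap fun i => (e i : A i →ₐ[R] B i)) :)
    (map_mul (piTensorMap fun i => (e i : A i →ₐ[R] B i)) :)

@[simp]
theorem piTensorCongr_tprod (e : ∀ i, A i ≃ₐ[R] B i) (a : ∀ i, A i) :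
    piTensorCongr e (tprod R a) = tprod R fun i => e i (a i) :=
  congr_tprod _ _

variable (R A B)

/-- The canonical homomorphism `(⨂ A i) ⊗ (⨂ B i) → ⨂ (A i ⊗ B i)`. -/
noncomputable def tensorPiHom :
    (⨂[R] i, A i) ⊗[R] (⨂[R] i, B i) →ₐ[R] ⨂[R] i, A i ⊗[R] B i :=
  Algebra.TensorProduct.lift (piTensorMap fun _ => Algebra.TensorProduct.includeLeft)
    (piTensorMap fun _ => Algebra.TensorProduct.includeRight) fun x y => by
      induction x using PiTensorProduct.induction_on with
      | add x x' hx hx' => rw [map_add]; exact hx.add_left hx'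
      | smul_tprod r a =>
        induction y using PiTensorProduct.induction_on with
        | add y y' hy hy' => rw [map_add]; exact hy.add_right hy'
        | smul_tprod s b =>
          rw [map_smul, map_smul, piTensorMap_tprod, piTensorMap_tprod]
          rw [Commute, SemiconjBy, smul_tprod_mul_smul_tprod, smul_tprod_mul_smul_tprod, mul_comm r s]
          congr 2
          exact funext fun i => by simp

variable {R A B}

@[simp]
theorem tensorPiHom_tmul (a : ∀ i, A i) (b : ∀ i, B i) :
    tensorPiHom R A B (tprod R a ⊗ₜ tprod R b) = tprod R fun i => a i ⊗ₜ[R] b i := by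
  rw [tensorPiHom, Algebra.TensorProduct.lift_tmul, piTensorMap_tprod, piTensorMap_tprod,
    tprod_mul_tprod]
  congr 1
  exact funext fun i => by simp

/-- A family is the product of its components in any order of the (finitely many) indices. -/
theorem list_prod_mulSingle [DecidableEq ι] [Fintype ι] {M : ι → Type*} [∀ i, Monoid (M i)]
    (l : List ι) (hl : l.Nodup) (hl' : l.toFinset = Finset.univ) (x : ∀ i, M i) :
    (l.map fun i => Pi.mulSingle i (x i)).prod = x := by
  rw [← Finset.noncommProd_toFinset l (fun i => Pi.mulSingle i (x i))
    (fun i _ j _ h => Pi.mulSingle_apply_commute x i j) hl]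
  simp only [hl']
  exact Finset.noncommProd_mulSingle x

/-- The inverse sends `⨂ t i` to the product of the images of the `t i` under the maps
`A i ⊗ B i → (⨂ A i) ⊗ (⨂ B i)`, multiplied in an arbitrary fixed order of the indices. -/
theorem tensorPiHom_bijective [Finite ι] : Function.Bijective (tensorPiHom R A B) := by
  classical
  obtain ⟨n, ⟨e⟩⟩ := Finite.exists_equiv_fin ι
  have := Fintype.ofFinite ι
  let s (i : ι) : A i ⊗[R] B i →ₐ[R] (⨂[R] i, A i) ⊗[R] (⨂[R] i, B i) :=
    Algebra.TensorProduct.map (singleAlgHom i) (singleAlgHom i)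
  let inv : (⨂[R] i, A i ⊗[R] B i) →ₗ[R] (⨂[R] i, A i) ⊗[R] (⨂[R] i, B i) :=
    lift (((MultilinearMap.mkPiAlgebraFin R n _).domDomCongr e.symm).compLinearMap
      fun i => (s i).toLinearMap)
  have hinv (a : ∀ i, A i) (b : ∀ i, B i) :
      inv (tprod R fun i => a i ⊗ₜ[R] b i) = tprod R a ⊗ₜ tprod R b := by
    -- `c ↦ (⨂ c.1) ⊗ (⨂ c.2)` is multiplicative, so its value on a family `c` is the product of
    -- its values on the components of `c`.
    let φ : (∀ i, A i × B i) →* (⨂[R] i, A i) ⊗[R] (⨂[R] i, B i) :=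
      { toFun := fun c => tprod R (fun i => (c i).1) ⊗ₜ tprod R (fun i => (c i).2)
        map_one' := rfl
        map_mul' := fun c d => by
          rw [Algebra.TensorProduct.tmul_mul_tmul, tprod_mul_tprod, tprod_mul_tprod]
          rfl }
    have h := congrArg φ (list_prod_mulSingle (List.ofFn e.symm)
      (List.nodup_ofFn.2 e.symm.injective) (by ext i; simpa using ⟨e i, by simp⟩)
      fun i => (a i, b i))
    rw [map_list_prod, List.map_map, List.map_ofFn] at h
    refine Eq.trans ?_ h
    simp only [inv, lift.tprod, MultilinearMap.compLinearMap_apply,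
      MultilinearMap.domDomCongr_apply, MultilinearMap.mkPiAlgebraFin_apply]
    congr 2
    funext k
    simp only [s, φ, AlgHom.toLinearMap_apply, Algebra.TensorProduct.map_tmul, Function.comp_apply,
      MonoidHom.coe_mk, OneHom.coe_mk, singleAlgHom_apply, MonoidHom.mulSingle_apply]
    congr 2 <;> funext i <;> by_cases hi : i = e.symm k
    all_goals first | (subst hi; simp) | simp [Pi.mulSingle_eq_of_ne hi]
  refine Function.bijective_iff_has_inverse.2 ⟨inv, fun x => ?_, fun y => ?_⟩
  · suffices inv ∘ₗ (tensorPiHom R A B).toLinearMap = LinearMap.id from LinearMap.congr_fun this x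
    refine TensorProduct.ext (PiTensorProduct.ext (MultilinearMap.ext fun a =>
      PiTensorProduct.ext (MultilinearMap.ext fun b => ?_)))
    simp [hinv]
  · suffices (tensorPiHom R A B).toLinearMap ∘ₗ inv = LinearMap.id from LinearMap.congr_fun this y
    refine PiTensorProduct.ext_of_span_eq_top (γ := fun i => A i × B i)
      (g := fun i c => c.1 ⊗ₜ[R] c.2) (fun i => ?_) fun c => ?_
    · rw [← TensorProduct.span_tmul_eq_top]
      congr 1
      ext t
      simp
    · simp [hinv]

variable (R A B) in
/-- The isomorphism `(⨂ A i) ⊗ (⨂ B i) ≅ ⨂ (A i ⊗ B i)`. -/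
noncomputable def tensorPiEquiv [Finite ι] :
    (⨂[R] i, A i) ⊗[R] (⨂[R] i, B i) ≃ₐ[R] ⨂[R] i, A i ⊗[R] B i :=
  AlgEquiv.ofBijective (tensorPiHom R A B) tensorPiHom_bijective

@[simp]
theorem tensorPiEquiv_tmul [Finite ι] (a : ∀ i, A i) (b : ∀ i, B i) :
    tensorPiEquiv R A B (tprod R a ⊗ₜ tprod R b) = tprod R fun i => a i ⊗ₜ[R] b i :=
  tensorPiHom_tmul a b

end Algebras

section Modules

variable {P : ι → Type*} [∀ i, AddCommGroup (P i)] [∀ i, Module R (P i)]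

variable (R P) in
/-- The canonical homomorphism `⨂ End (P i) → End (⨂ P i)`. -/
noncomputable def endPiHom :
    (⨂[R] i, Module.End R (P i)) →ₐ[R] Module.End R (⨂[R] i, P i) :=
  liftAlgHom (PiTensorProduct.mapMultilinear R P P) PiTensorProduct.map_one
    fun f g => PiTensorProduct.map_mul f g

@[simp]
theorem endPiHom_tprod (f : ∀ i, Module.End R (P i)) :
    endPiHom R P (tprod R f) = PiTensorProduct.map f :=
  lift.tprod f

/-- For dual bases `m i`, `f i` of the `P i`, the inverse sends `Φ` to the sum over all `j` of
`Φ (⨂ m i (j i))` with each `p` in the factor `P i` replaced by `f i (j i) · p`. -/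
theorem endPiHom_bijective [Finite ι] [∀ i, Module.Finite R (P i)]
    [∀ i, Module.Projective R (P i)] : Function.Bijective (endPiHom R P) := by
  classical
  have := Fintype.ofFinite ι
  choose n m f h using fun i => exists_dual_basis R (P i)
  let c (j : ∀ i, Fin (n i)) : (⨂[R] i, P i) →ₗ[R] ⨂[R] i, Module.End R (P i) :=
    PiTensorProduct.map fun i => LinearMap.smulRightₗ (f i (j i))
  let inv : Module.End R (⨂[R] i, P i) →ₗ[R] ⨂[R] i, Module.End R (P i) :=
    ∑ j : ∀ i, Fin (n i), (c j).comp (LinearMap.applyₗ (tprod R fun i => m i (j i)))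
  have hend (i : ι) (φ : Module.End R (P i)) :
      ∑ j, LinearMap.smulRight (f i j) (φ (m i j)) = φ := by
    ext x
    conv_rhs => rw [← h i x]
    simp [map_sum]
  refine Function.bijective_iff_has_inverse.2 ⟨inv, fun x => ?_, fun Φ => ?_⟩
  · suffices inv ∘ₗ (endPiHom R P).toLinearMap = LinearMap.id from LinearMap.congr_fun this x
    refine PiTensorProduct.ext (MultilinearMap.ext fun φ => ?_)
    have h1 : φ = fun i => ∑ j, LinearMap.smulRight (f i j) (φ i (m i j)) :=
      funext fun i => (hend i (φ i)).symm
    simp only [LinearMap.compMultilinearMap_apply, LinearMap.id_apply, LinearMap.comp_apply]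
    conv_rhs => rw [h1, MultilinearMap.map_sum]
    simp [inv, c, LinearMap.smulRightₗ]
  · refine PiTensorProduct.ext (MultilinearMap.ext fun x => ?_)
    have hc (j : ∀ i, Fin (n i)) (z : ⨂[R] i, P i) :
        endPiHom R P (c j z) (tprod R x) = (∏ i, f i (j i) (x i)) • z := by
      induction z using PiTensorProduct.induction_on with
      | add a b ha hb => rw [map_add, map_add, LinearMap.add_apply, ha, hb, smul_add]
      | smul_tprod r p =>
        simp only [c, map_smul, PiTensorProduct.map_tprod, endPiHom_tprod, LinearMap.smul_apply,
          LinearMap.smulRightₗ_apply, LinearMap.smulRight_apply]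
        rw [MultilinearMap.map_smul_univ, smul_comm]
    have h1 : x = fun i => ∑ j, f i j (x i) • m i j := funext fun i => (h i (x i)).symm
    simp only [LinearMap.compMultilinearMap_apply]
    conv_rhs => rw [h1, MultilinearMap.map_sum]
    simp only [inv, LinearMap.sum_apply, LinearMap.comp_apply, map_sum, hc,
      MultilinearMap.map_smul_univ, map_smul, LinearMap.applyₗ_apply_apply]

variable (R P) in
/-- The isomorphism `⨂ End (P i) ≅ End (⨂ P i)` for finitely generated projective `P i`. -/
noncomputable def endPiEquiv [Finite ι] [∀ i, Module.Finite R (P i)]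
    [∀ i, Module.Projective R (P i)] :
    (⨂[R] i, Module.End R (P i)) ≃ₐ[R] Module.End R (⨂[R] i, P i) :=
  AlgEquiv.ofBijective (endPiHom R P) endPiHom_bijective

@[simp]
theorem endPiEquiv_tprod [Finite ι] [∀ i, Module.Finite R (P i)]
    [∀ i, Module.Projective R (P i)] (f : ∀ i, Module.End R (P i)) :
    endPiEquiv R P (tprod R f) = PiTensorProduct.map f :=
  endPiHom_tprod f

/-- Each `P i` is a retract of a finite free module, hence so is `⨂ P i`. -/
theorem projective_piTensor [Finite ι] [∀ i, Module.Finite R (P i)]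
    [∀ i, Module.Projective R (P i)] : Module.Projective R (⨂[R] i, P i) := by
  choose n f g _ _ h using fun i => Module.Finite.exists_comp_eq_id_of_projective R (P i)
  have : Module.Free R (⨂[R] i, Fin (n i) → R) :=
    .of_basis (Basis.piTensorProduct fun i => Pi.basisFun R (Fin (n i)))
  refine .of_split (PiTensorProduct.map g) (PiTensorProduct.map f) ?_
  rw [← PiTensorProduct.map_comp]
  simp only [h, PiTensorProduct.map_id]

/-- The trace ideal of `⨂ P i` contains the product of the trace ideals of the `P i`. -/
theorem IsGenerator.piTensor [Finite ι] (h : ∀ i, IsGenerator R (P i)) :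
    IsGenerator R (⨂[R] i, P i) := by
  have := Fintype.ofFinite ι
  unfold IsGenerator at *
  have h1 : ∏ i : ι, Ideal.span {r : R | ∃ (f : P i →ₗ[R] R) (p : P i), f p = r} = ⊤ := by
    rw [Finset.prod_congr rfl fun i _ => h i, Finset.prod_const, Ideal.top_pow]
  rw [Ideal.prod_span] at h1
  refine top_le_iff.1 (h1.symm.le.trans (Ideal.span_mono fun r hr => ?_))
  obtain ⟨s, hs, rfl⟩ := Set.mem_fintype_prod _ _ |>.1 hr
  choose f p hfp using hs
  exact ⟨dualDistrib (tprod R f), tprod R p, by simp [hfp]⟩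

theorem IsProgenerator.piTensor [Finite ι] (h : ∀ i, IsProgenerator R (P i)) :
    IsProgenerator R (⨂[R] i, P i) := by
  have := fun i => (h i).finite
  have := fun i => (h i).projective
  exact ⟨inferInstance, projective_piTensor, .piTensor fun i => (h i).generator⟩

theorem IsGenerator.faithfulSMul {M : Type*} [AddCommGroup M] [Module R M]
    (h : IsGenerator R M) : FaithfulSMul R M := by
  refine ⟨fun {r s} hrs => sub_eq_zero.1 ?_⟩
  have h1 : Ideal.span {r : R | ∃ (f : M →ₗ[R] R) (p : M), f p = r} ≤
      LinearMap.ker (LinearMap.toSpanSingleton R R (r - s)) := by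
    rw [Ideal.span_le]
    rintro _ ⟨f, p, rfl⟩
    have : (r - s) • p = 0 := by rw [sub_smul, hrs p, sub_self]
    simpa [mul_comm] using congrArg f this
  unfold IsGenerator at h
  simpa using h1 (h ▸ Submodule.mem_top : (1 : R) ∈ _)

end Modules

/-- The map `A ⊗ Aᵐᵒᵖ → End A` for `A = ⨂ A i` is the composite of `A ⊗ Aᵐᵒᵖ ≅ ⨂ (A i ⊗ (A i)ᵐᵒᵖ)`,
the corresponding maps for the `A i`, and `⨂ End (A i) ≅ End (⨂ A i)`. -/
theorem isAzumaya_piTensor [Finite ι] {A : ι → Type*} [∀ i, Ring (A i)] [∀ i, Algebra R (A i)]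
    (h : ∀ i, IsAzumaya R (A i)) : IsAzumaya R (⨂[R] i, A i) := by
  have hP : IsProgenerator R (⨂[R] i, A i) :=
    .piTensor fun i => isProgenerator_of_isAzumaya (A i)
  have := hP.finite
  have := hP.projective
  have := hP.generator.faithfulSMul
  refine ⟨?_⟩
  let op : (⨂[R] i, A i)ᵐᵒᵖ ≃ₗ[R] ⨂[R] i, (A i)ᵐᵒᵖ :=
    (MulOpposite.opLinearEquiv R).symm ≪≫ₗ PiTensorProduct.congr fun _ => MulOpposite.opLinearEquiv R
  let e : (⨂[R] i, A i) ⊗[R] (⨂[R] i, A i)ᵐᵒᵖ ≃ₗ[R] Module.End R (⨂[R] i, A i) :=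
    TensorProduct.congr (.refl R _) op ≪≫ₗ
      (tensorPiEquiv R A fun i => (A i)ᵐᵒᵖ).toLinearEquiv ≪≫ₗ
      PiTensorProduct.congr (fun i => LinearEquiv.ofBijective
        (AlgHom.mulLeftRight R (A i)).toLinearMap (h i).bij) ≪≫ₗ
      (endPiEquiv R A).toLinearEquiv
  have key : (AlgHom.mulLeftRight R (⨂[R] i, A i)).toLinearMap = e.toLinearMap := by
    refine TensorProduct.ext (PiTensorProduct.ext (MultilinearMap.ext fun a => ?_))
    rw [← LinearMap.cancel_right (MulOpposite.opLinearEquiv R).surjective]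
    refine (PiTensorProduct.ext (MultilinearMap.ext fun b =>
      PiTensorProduct.ext (MultilinearMap.ext fun x => ?_)))
    simp only [e, op, LinearMap.compMultilinearMap_apply, LinearMap.comp_apply]
    simp
    congr 1
    exact funext fun i =>
      (AlgHom.mulLeftRight_apply R (A i) (a i) (MulOpposite.op (b i)) (x i)).symm
  have := e.bijective
  rwa [← LinearEquiv.coe_coe, ← key] at this

end PiTensor

/-! ### Transport along semilinear equivalences -/

section Transport

variable {R : Type*} [CommRing R] {σ τ : R →+* R} [RingHomInvPair σ τ] [RingHomInvPair τ σ]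

theorem IsProgenerator.of_semilinearEquiv {M N : Type*} [AddCommGroup M] [Module R M]
    [AddCommGroup N] [Module R N] (e : M ≃ₛₗ[σ] N) (hN : IsProgenerator R N) :
    IsProgenerator R M := by
  have := hN.finite
  have := hN.projective
  have := hN.generator.faithfulSMul
  have : Module.Finite R M := .of_surjective e.symm.toLinearMap e.symm.surjective
  have : Module.Projective R M := .of_equiv e.symm
  have : FaithfulSMul R M := ⟨fun {r s} h =>
    (RingHomInvPair.toRingEquiv σ τ).injective <|
    FaithfulSMul.eq_of_smul_eq_smul (α := N) fun n => by
      obtain ⟨m, rfl⟩ := e.surjective n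
      have := congrArg e (h m)
      rwa [map_smulₛₗ, map_smulₛₗ] at this⟩
  exact ⟨inferInstance, inferInstance, .of_faithful⟩

/-- Azumaya algebras are stable under twisting the scalars by an automorphism of `R`: a
multiplicative semilinear equivalence carries `A ⊗ Aᵐᵒᵖ → End A` to `B ⊗ Bᵐᵒᵖ → End B`. -/
theorem isAzumaya_of_semilinearEquiv {A B : Type*} [Ring A] [Ring B] [Algebra R A] [Algebra R B]
    (e : A ≃ₛₗ[σ] B) (he : ∀ x y, e (x * y) = e x * e y) (hB : IsAzumaya R B) :
    IsAzumaya R A := by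
  have hA := (isProgenerator_of_isAzumaya (R := R) B).of_semilinearEquiv e
  have := hA.finite
  have := hA.projective
  have := hA.generator.faithfulSMul
  let eop : Aᵐᵒᵖ ≃ₛₗ[σ] Bᵐᵒᵖ :=
    ((MulOpposite.opLinearEquiv R).symm.trans e).trans (MulOpposite.opLinearEquiv R)
  let E : A ⊗[R] Aᵐᵒᵖ ≃ₛₗ[σ] B ⊗[R] Bᵐᵒᵖ := TensorProduct.congr e eop
  have key (t : A ⊗[R] Aᵐᵒᵖ) (x : A) :
      AlgHom.mulLeftRight R B (E t) (e x) = e (AlgHom.mulLeftRight R A t x) := by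
    induction t with
    | zero => simp
    | add s t hs ht =>
      rw [map_add, map_add, map_add, LinearMap.add_apply, LinearMap.add_apply, hs, ht, map_add]
    | tmul a b =>
      change AlgHom.mulLeftRight R B (e a ⊗ₜ MulOpposite.op (e b.unop)) (e x) = _
      rw [AlgHom.mulLeftRight_apply, AlgHom.mulLeftRight_apply, he, he, MulOpposite.unop_op]
  refine ⟨fun s t h => E.injective (hB.bij.1 (LinearMap.ext fun y => ?_)), fun φ => ?_⟩
  · obtain ⟨x, rfl⟩ := e.surjective y
    rw [key, key, h]
  · obtain ⟨s, hs⟩ := hB.bij.2 ((e.toLinearMap.comp φ).comp e.symm.toLinearMap : B →ₗ[R] B)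
    refine ⟨E.symm s, LinearMap.ext fun x => e.injective ?_⟩
    rw [← key, E.apply_symm_apply, hs]
    simp

end Transport

variable {G : Type v} {R : Type u} [Group G] [CommRing R] [MulSemiringAction G R]
variable {H : Subgroup G}

/-! ### The components of the induced module -/

instance ringHomInvPair_inv_smul (g : G) : RingHomInvPair (MulSemiringAction.toRingHom G R g⁻¹)
    (MulSemiringAction.toRingHom G R g) :=
  ⟨RingHom.ext fun r => smul_inv_smul g r, RingHom.ext fun r => inv_smul_smul g r⟩

instance ringHomInvPair_smul_inv (g : G) : RingHomInvPair (MulSemiringAction.toRingHom G R g)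
    (MulSemiringAction.toRingHom G R g⁻¹) :=
  ⟨RingHom.ext fun r => inv_smul_smul g r, RingHom.ext fun r => smul_inv_smul g r⟩

theorem inv_mul_mem_of_mk_eq {ω : G ⧸ H} (x y : {x : G // (x : G ⧸ H) = ω}) :
    y.1⁻¹ * x.1 ∈ H :=
  QuotientGroup.eq.1 (y.2.trans x.2.symm)

namespace Component

variable {A B : GAlgebra.{u, v, w} H R} {ω ω' : G ⧸ H}

/-- Evaluation at a representative `x` of the coset `ω` identifies `A_ω` with `A`, semilinearly
over the action of `x⁻¹` on `R`. -/
def eval (A : GAlgebra.{u, v, w} H R) (x : {x : G // (x : G ⧸ H) = ω}) :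
    Component H A ω ≃ₛₗ[MulSemiringAction.toRingHom G R x.1⁻¹] A.carrier where
  toFun f := f.1 x
  map_add' _ _ := rfl
  map_smul' r f := smul_val r f x
  invFun a := ⟨fun y => (⟨y.1⁻¹ * x.1, inv_mul_mem_of_mk_eq x y⟩ : H) • a, fun y z h e =>
    (congrArg (· • a) (Subtype.ext (by simp [e, mul_assoc]))).trans
      (mul_smul h⁻¹ (⟨y.1⁻¹ * x.1, inv_mul_mem_of_mk_eq x y⟩ : H) a)⟩
  left_inv f := ext fun y => by
    refine (f.2 x y (⟨y.1⁻¹ * x.1, inv_mul_mem_of_mk_eq x y⟩⁻¹ : H) (by simp)).trans ?_ |>.symm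
    rw [inv_inv]
  right_inv a := by
    have : (⟨x.1⁻¹ * x.1, inv_mul_mem_of_mk_eq x x⟩ : H) = 1 := by ext; simp
    exact (congrArg (· • a) this).trans (one_smul _ _)

/-- The homomorphism `A_ω → B_ω` induced by an `H`-equivariant homomorphism `A → B`. -/
def map (φ : A.carrier →ₐ[R] B.carrier) (hφ : ∀ (h : H) a, φ (h • a) = h • φ a) (ω : G ⧸ H) :
    Component H A ω →ₐ[R] Component H B ω where
  toFun f := ⟨fun x => φ (f.1 x), fun x y h e =>
    (congrArg φ (f.2 x y h e)).trans (hφ _ _)⟩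
  map_one' := ext fun _ => map_one φ
  map_mul' _ _ := ext fun _ => map_mul φ _ _
  map_zero' := ext fun _ => map_zero φ
  map_add' _ _ := ext fun _ => map_add φ _ _
  commutes' _ := ext fun _ => φ.commutes _

/-- The isomorphism `A_ω ≅ B_ω` induced by an isomorphism of `H`-algebras `A ≅ B`. -/
def congr (e : GAlgebra.Iso A B) (ω : G ⧸ H) : Component H A ω ≃ₐ[R] Component H B ω :=
  AlgEquiv.ofAlgHom (map e.toAlgEquiv e.map_smul ω) (map e.symm.toAlgEquiv e.symm.map_smul ω)
    (AlgHom.ext fun _ => ext fun _ => e.toAlgEquiv.apply_symm_apply _)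
    (AlgHom.ext fun _ => ext fun _ => e.toAlgEquiv.symm_apply_apply _)

variable (A B) in
/-- The canonical homomorphism `A_ω ⊗ B_ω → (A ⊗ B)_ω`. -/
noncomputable def tensorHom (ω : G ⧸ H) :
    Component H A ω ⊗[R] Component H B ω →ₐ[R] Component H (A.tensor B) ω :=
  Algebra.TensorProduct.lift
    (map (B := A.tensor B) (Algebra.TensorProduct.includeLeft :
        A.carrier →ₐ[R] A.carrier ⊗[R] B.carrier)
      (fun h a => congrArg ((h • a) ⊗ₜ[R] ·) (smul_one h).symm) ω)
    (map (B := A.tensor B) (Algebra.TensorProduct.includeRight :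
        B.carrier →ₐ[R] A.carrier ⊗[R] B.carrier)
      (fun h b => congrArg (· ⊗ₜ[R] (h • b)) (smul_one h).symm) ω)
    fun a b => ext fun x =>
      (Algebra.TensorProduct.tmul_mul_tmul _ _ _ _).trans <| by
        refine Eq.trans ?_ (Algebra.TensorProduct.tmul_mul_tmul _ _ _ _).symm
        rw [one_mul, one_mul, mul_one, mul_one]

theorem tensorHom_tmul_val (a : Component H A ω) (b : Component H B ω)
    (x : {x : G // (x : G ⧸ H) = ω}) :
    (tensorHom A B ω (a ⊗ₜ b)).1 x = a.1 x ⊗ₜ[R] b.1 x := by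
  refine (congrArg (fun t : Component H (A.tensor B) ω => t.1 x)
    (Algebra.TensorProduct.lift_tmul _ _ _ _ _)).trans ?_
  refine (Algebra.TensorProduct.tmul_mul_tmul (a.1 x) 1 1 (b.1 x)).trans ?_
  rw [one_mul, mul_one]

/-- Evaluation at a representative of `ω` turns the canonical map into the tensor product of two
semilinear equivalences. -/
theorem tensorHom_bijective (ω : G ⧸ H) : Function.Bijective (tensorHom A B ω) := by
  obtain ⟨x, rfl⟩ := QuotientGroup.mk_surjective ω
  let y : {y : G // (y : G ⧸ H) = x} := ⟨x, rfl⟩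
  have key : ⇑(eval (A.tensor B) y) ∘ tensorHom A B x =
      TensorProduct.congr (eval A y) (eval B y) := funext fun t => by
    induction t with
    | zero =>
      rw [Function.comp_apply, map_zero, map_zero, map_zero]
      rfl
    | add s t hs ht =>
      rw [Function.comp_apply] at *
      rw [map_add, map_add, map_add, hs, ht]
      rfl
    | tmul a b => exact tensorHom_tmul_val a b y
  refine ((eval (A.tensor B) y).bijective.of_comp_iff' _).1 ?_
  rw [key]
  exact LinearEquiv.bijective _

variable (A B) in
/-- The isomorphism `A_ω ⊗ B_ω ≅ (A ⊗ B)_ω`. -/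
noncomputable def tensorEquiv (ω : G ⧸ H) :
    Component H A ω ⊗[R] Component H B ω ≃ₐ[R] Component H (A.tensor B) ω :=
  AlgEquiv.ofBijective (tensorHom A B ω) (tensorHom_bijective ω)

theorem isAzumaya (hA : IsAzumaya R A.carrier) (ω : G ⧸ H) :
    IsAzumaya R (Component H A ω) := by
  obtain ⟨x, rfl⟩ := QuotientGroup.mk_surjective ω
  exact isAzumaya_of_semilinearEquiv (eval A ⟨x, rfl⟩) (fun _ _ => rfl) hA

end Component

/-! ### Tensor induction of modules -/

section ModuleComponent

variable (H) (P : GModule.{u, v, w} H R)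

/-- The underlying additive group of `ModuleComponent`. -/
def moduleComponentAddSubgroup (ω : G ⧸ H) :
    AddSubgroup ({x : G // (x : G ⧸ H) = ω} → P.carrier) where
  carrier := {f | ∀ (x y : {x : G // (x : G ⧸ H) = ω}) (h : H), y.1 = x.1 * h → f y = h⁻¹ • f x}
  add_mem' hf hg x y h e := by simp [hf x y h e, hg x y h e]
  zero_mem' x y h e := by simp
  neg_mem' hf x y h e := by simp [hf x y h e]

/-- The component `P_ω = g ⊗ P`, for a coset `ω = gH`, of the module `RG ⊗_{RH} P` induced by an
`R`-module `P` with compatible `H`-action. As for `Component`, an element `x ⊗ p` is represented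
by the function on `ω` with value `p` at `x`. -/
def ModuleComponent (ω : G ⧸ H) : Type (max v w) := moduleComponentAddSubgroup H P ω

namespace ModuleComponent

variable {H P} {ω ω' : G ⧸ H}

instance : AddCommGroup (ModuleComponent H P ω) :=
  inferInstanceAs (AddCommGroup (moduleComponentAddSubgroup H P ω))

theorem ext {f g : ModuleComponent H P ω} (h : ∀ x, f.1 x = g.1 x) : f = g :=
  Subtype.ext (funext h)

/-- The scalar `r` acts on values at `x` by `x⁻¹ • r`. -/
instance : Module R (ModuleComponent H P ω) where
  smul r f := ⟨fun x => (x.1⁻¹ • r) • f.1 x, fun x y h e => by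
    have : h⁻¹ • x.1⁻¹ • r = y.1⁻¹ • r := by
      rw [e, mul_inv_rev, mul_smul]
      rfl
    exact (congrArg₂ (· • ·) this.symm (f.2 x y h e)).trans
      (smul_distrib_smul h⁻¹ (x.1⁻¹ • r) (f.1 x)).symm⟩
  one_smul f := ext fun x => (congrArg (· • f.1 x) (smul_one _)).trans (one_smul _ _)
  mul_smul r s f := ext fun x => (congrArg (· • f.1 x) (smul_mul' _ _ _)).trans (mul_smul _ _ _)
  smul_zero r := ext fun _ => smul_zero _
  smul_add r f g := ext fun _ => smul_add _ _ _
  add_smul r s f := ext fun x => (congrArg (· • f.1 x) (smul_add _ _ _)).trans (add_smul _ _ _)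
  zero_smul f := ext fun x => (congrArg (· • f.1 x) (smul_zero _)).trans (zero_smul _ _)

theorem smul_val (r : R) (f : ModuleComponent H P ω) (x : {x : G // (x : G ⧸ H) = ω}) :
    (r • f).1 x = (x.1⁻¹ • r) • f.1 x := rfl

/-- Left multiplication by `g` on the induced module, `x ⊗ p ↦ g x ⊗ p`, as a map from `P_ω'` to
`P_ω` where `ω = g ω'`. -/
def translate (g : G) (e : g • ω' = ω) : ModuleComponent H P ω' →+ ModuleComponent H P ω where
  toFun f := ⟨fun x => f.1 ⟨g⁻¹ * x.1, by
      have : ω' = g⁻¹ • ω := by rw [← e, inv_smul_smul]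
      exact (congrArg (g⁻¹ • ·) x.2).trans this.symm⟩,
    fun x y h hy => f.2 _ _ h (by simp [hy, mul_assoc])⟩
  map_zero' := rfl
  map_add' _ _ := rfl

theorem translate_smul (g : G) (e : g • ω' = ω) (r : R) (f : ModuleComponent H P ω') :
    translate g e (r • f) = (g • r) • translate g e f := ext fun x => by
  rw [smul_val]
  change (r • f).1 _ = _ • f.1 _
  rw [smul_val]
  simp [mul_smul]

/-- Evaluation at a representative `x` of the coset `ω` identifies `P_ω` with `P`, semilinearly
over the action of `x⁻¹` on `R`. -/
def eval (P : GModule.{u, v, w} H R) (x : {x : G // (x : G ⧸ H) = ω}) :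
    ModuleComponent H P ω ≃ₛₗ[MulSemiringAction.toRingHom G R x.1⁻¹] P.carrier where
  toFun f := f.1 x
  map_add' _ _ := rfl
  map_smul' r f := smul_val r f x
  invFun a := ⟨fun y => (⟨y.1⁻¹ * x.1, inv_mul_mem_of_mk_eq x y⟩ : H) • a, fun y z h e =>
    (congrArg (· • a) (Subtype.ext (by simp [e, mul_assoc]))).trans
      (mul_smul h⁻¹ (⟨y.1⁻¹ * x.1, inv_mul_mem_of_mk_eq x y⟩ : H) a)⟩
  left_inv f := ext fun y => by
    refine (f.2 x y (⟨y.1⁻¹ * x.1, inv_mul_mem_of_mk_eq x y⟩⁻¹ : H) (by simp)).trans ?_ |>.symm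
    rw [inv_inv]
  right_inv a := by
    have : (⟨x.1⁻¹ * x.1, inv_mul_mem_of_mk_eq x x⟩ : H) = 1 := by ext; simp
    exact (congrArg (· • a) this).trans (one_smul _ _)

theorem isProgenerator (hP : IsProgenerator R P.carrier) (ω : G ⧸ H) :
    IsProgenerator R (ModuleComponent H P ω) := by
  obtain ⟨x, rfl⟩ := QuotientGroup.mk_surjective ω
  exact hP.of_semilinearEquiv (eval P ⟨x, rfl⟩)

end ModuleComponent

variable {H P}

/-- The value at `x` of an element of `(End P)_ω`, as an endomorphism of `P`. -/
def endVal {ω : G ⧸ H} (φ : Component H P.endAlgebra ω) (x : {x : G // (x : G ⧸ H) = ω}) :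
    Module.End R P.carrier := φ.1 x

/-- The canonical homomorphism `(End P)_ω → End (P_ω)`: functions on `ω` are applied pointwise. -/
def endComponentHom (P : GModule.{u, v, w} H R) (ω : G ⧸ H) :
    Component H P.endAlgebra ω →ₐ[R] Module.End R (ModuleComponent H P ω) where
  toFun φ :=
    { toFun := fun p => ⟨fun x => endVal φ x (p.1 x), fun x y h e => by
        refine (congrArg₂ (fun (α : Module.End R P.carrier) q => α q)
          (φ.2 x y h e) (p.2 x y h e)).trans ?_
        exact congrArg (fun q => h⁻¹ • endVal φ x q) (inv_smul_smul h⁻¹ (p.1 x))⟩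
      map_add' := fun p q =>
        ModuleComponent.ext fun x => (endVal φ x).map_add _ _
      map_smul' := fun r p =>
        ModuleComponent.ext fun x => (endVal φ x).map_smul _ _ }
  map_one' := rfl
  map_mul' _ _ := rfl
  map_zero' := rfl
  map_add' _ _ := rfl
  commutes' _ := rfl

/-- Under evaluation at a representative of `ω`, the canonical map becomes conjugation by the
semilinear equivalence `P_ω ≅ P`. -/
theorem endComponentHom_bijective (ω : G ⧸ H) : Function.Bijective (endComponentHom P ω) := by
  obtain ⟨x, rfl⟩ := QuotientGroup.mk_surjective ω
  let y : {y : G // (y : G ⧸ H) = x} := ⟨x, rfl⟩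
  let e := ModuleComponent.eval P y
  let E := Component.eval P.endAlgebra y
  refine ⟨fun φ ψ h => E.injective (LinearMap.ext fun p => ?_), fun Φ => ?_⟩
  · obtain ⟨q, rfl⟩ := e.surjective p
    exact congrArg (fun Φ : Module.End R (ModuleComponent H P x) => (Φ q).1 y) h
  · let φ : P.carrier →ₗ[R] P.carrier := (e.toLinearMap.comp Φ).comp e.symm.toLinearMap
    refine ⟨E.symm φ, LinearMap.ext fun p => e.injective ?_⟩
    have h1 : endVal (E.symm φ) y = φ := E.apply_symm_apply φ
    change endVal (E.symm φ) y (e p) = _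
    rw [h1]
    exact congrArg (fun q => e (Φ q)) (e.symm_apply_apply p)

/-- The isomorphism `(End P)_ω ≅ End (P_ω)`. -/
noncomputable def endComponentEquiv (P : GModule.{u, v, w} H R) (ω : G ⧸ H) :
    Component H P.endAlgebra ω ≃ₐ[R] Module.End R (ModuleComponent H P ω) :=
  AlgEquiv.ofBijective (endComponentHom P ω) (endComponentHom_bijective ω)

end ModuleComponent

section ModuleInduction

open PiTensorProduct

variable (H) (P : GModule.{u, v, w} H R)

/-- The action of `g` on a family `(p_ω)`: the new component at `ω` is `g p_{g⁻¹ω}`. -/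
def moduleTranslateFamily (g : G) (a : ∀ ω, ModuleComponent H P ω) (ω : G ⧸ H) :
    ModuleComponent H P ω :=
  ModuleComponent.translate g (smul_inv_smul g ω) (a (g⁻¹ • ω))

variable {H P}

theorem moduleTranslateFamily_apply_self (g : G) (a : ∀ ω, ModuleComponent H P ω) (i : G ⧸ H) :
    moduleTranslateFamily H P g a (g • i) = ModuleComponent.translate g rfl (a i) := by
  have : ∀ (ω' : G ⧸ H) (e : g • ω' = g • i) (_ : ω' = i),
      ModuleComponent.translate g e (a ω') = ModuleComponent.translate g rfl (a i) := by
    rintro _ e rfl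
    rfl
  exact this _ _ (inv_smul_smul g i)

theorem moduleTranslateFamily_update [DecidableEq (G ⧸ H)] (g : G)
    (a : ∀ ω, ModuleComponent H P ω) (i : G ⧸ H) (m : ModuleComponent H P i) :
    moduleTranslateFamily H P g (Function.update a i m) =
      Function.update (moduleTranslateFamily H P g a) (g • i)
        (ModuleComponent.translate g rfl m) := by
  funext ω
  obtain ⟨j, rfl⟩ : ∃ j, g • j = ω := ⟨g⁻¹ • ω, smul_inv_smul g ω⟩
  rw [moduleTranslateFamily_apply_self]
  by_cases h : j = i
  · subst h
    rw [Function.update_self, Function.update_self]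
  · rw [Function.update_of_ne h, Function.update_of_ne ((MulAction.injective g).ne h),
      moduleTranslateFamily_apply_self]

theorem moduleTranslateFamily_one (a : ∀ ω, ModuleComponent H P ω) :
    moduleTranslateFamily H P 1 a = a := by
  have : ∀ (ω ω' : G ⧸ H) (e : (1 : G) • ω' = ω) (_ : ω' = ω),
      ModuleComponent.translate 1 e (a ω') = a ω := by
    rintro ω _ e rfl
    exact ModuleComponent.ext fun x => congrArg (a _).1 (Subtype.ext (by simp))
  exact funext fun ω => this _ _ _ (by simp)

theorem moduleTranslateFamily_mul (g h : G) (a : ∀ ω, ModuleComponent H P ω) :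
    moduleTranslateFamily H P (g * h) a =
      moduleTranslateFamily H P g (moduleTranslateFamily H P h a) := by
  have : ∀ (ω ω' ω'' : G ⧸ H) (e : (g * h) • ω' = ω) (e' : g • h • ω'' = ω) (_ : ω' = ω''),
      ModuleComponent.translate (g * h) e (a ω') =
        ModuleComponent.translate g e' (ModuleComponent.translate h rfl (a ω'')) := by
    rintro ω ω' _ e e' rfl
    exact ModuleComponent.ext fun x => congrArg (a _).1 (Subtype.ext (by simp [mul_assoc]))
  funext ω
  obtain ⟨η, rfl⟩ : ∃ η, g • h • η = ω := ⟨h⁻¹ • g⁻¹ • ω, by simp⟩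
  rw [moduleTranslateFamily_apply_self, moduleTranslateFamily_apply_self]
  exact this _ _ _ _ rfl (by simp [mul_smul])

/-- The action of `g` on `⨂ P_ω`: `g • (r ⨂ p_ω) = (g • r) ⨂ (g p_{g⁻¹ω})`. -/
noncomputable def moduleTensorInductionAct (g : G) :
    (⨂[R] ω : G ⧸ H, ModuleComponent H P ω) →+ ⨂[R] ω : G ⧸ H, ModuleComponent H P ω := by
  classical
  exact liftAddHom (fun p => (g • p.1) • PiTensorProduct.tprod R (moduleTranslateFamily H P g p.2))
    (fun r a i h => by
      have h0 : moduleTranslateFamily H P g a (g • i) = 0 := by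
        rw [moduleTranslateFamily_apply_self, h, map_zero]
      exact (congrArg _ ((PiTensorProduct.tprod R).map_coord_zero (g • i) h0)).trans (smul_zero _))
    (fun a => by simp)
    (fun {_} r a i m₁ m₂ => by
      simp only [moduleTranslateFamily_update, map_add, MultilinearMap.map_update_add, smul_add])
    (fun r r' a => by simp [add_smul])
    (fun {_} r a i r' => by
      simp only [moduleTranslateFamily_update, ModuleComponent.translate_smul,
        MultilinearMap.map_update_smul]
      rw [← moduleTranslateFamily_apply_self, Function.update_eq_self, smul_smul, smul_mul',
        mul_comm])

theorem moduleTensorInductionAct_smul_tprod (g : G) (r : R) (a : ∀ ω, ModuleComponent H P ω) :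
    moduleTensorInductionAct g (r • PiTensorProduct.tprod R a) =
      (g • r) • PiTensorProduct.tprod R (moduleTranslateFamily H P g a) := by
  rw [← tprodCoeff_eq_smul_tprod]
  rfl

variable (H P)

/-- The tensor induced module `P^{⊗G} = ⨂_{ω ∈ G/H} P_ω` of an `R`-module `P` with compatible
`H`-action, with `g • ⨂ p_ω = ⨂ (g p_{g⁻¹ω})`. -/
noncomputable def moduleTensorInduction : GModule.{u, v, max u v w} G R where
  carrier := ⨂[R] ω : G ⧸ H, ModuleComponent H P ω
  action :=
    { smul := fun g => moduleTensorInductionAct g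
      one_smul := fun x => by
        change moduleTensorInductionAct 1 x = x
        induction x using PiTensorProduct.induction_on with
        | smul_tprod r a =>
          rw [moduleTensorInductionAct_smul_tprod, moduleTranslateFamily_one, one_smul]
        | add x y hx hy => rw [map_add, hx, hy]
      mul_smul := fun g h x => by
        change moduleTensorInductionAct _ x =
          moduleTensorInductionAct _ (moduleTensorInductionAct _ x)
        induction x using PiTensorProduct.induction_on with
        | smul_tprod r a =>
          simp only [moduleTensorInductionAct_smul_tprod, moduleTranslateFamily_mul, mul_smul]
        | add x y hx hy => rw [map_add, map_add, map_add, hx, hy]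
      smul_zero := fun g => map_zero (moduleTensorInductionAct g)
      smul_add := fun g => map_add (moduleTensorInductionAct g) }
  compat := @SMulDistribClass.mk _ _ _ _ (_) _ fun g r x => by
    change moduleTensorInductionAct g (r • x) = (g • r) • moduleTensorInductionAct g x
    induction x using PiTensorProduct.induction_on with
    | smul_tprod s a =>
      rw [smul_smul, moduleTensorInductionAct_smul_tprod, moduleTensorInductionAct_smul_tprod,
        smul_smul, smul_mul']
    | add x y hx hy => rw [smul_add, map_add, map_add, hx, hy, smul_add]

variable {P}

/-- The pure tensor `⨂ p_ω` as an element of `P^{⊗G}`. -/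
noncomputable def modulePureTensor (a : ∀ ω, ModuleComponent H P ω) :
    (moduleTensorInduction H P).carrier :=
  PiTensorProduct.tprod R a

variable {H}

theorem smul_modulePureTensor (g : G) (a : ∀ ω, ModuleComponent H P ω) :
    g • modulePureTensor H a = modulePureTensor H (moduleTranslateFamily H P g a) := by
  have := moduleTensorInductionAct_smul_tprod (R := R) g 1 a
  rw [one_smul, smul_one, one_smul] at this
  exact this

variable (H)

theorem isProgenerator_moduleTensorInduction [H.FiniteIndex] (hP : IsProgenerator R P.carrier) :
    IsProgenerator R (moduleTensorInduction H P).carrier :=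
  have := Subgroup.finite_quotient_of_finiteIndex (H := H)
  IsProgenerator.piTensor fun ω => ModuleComponent.isProgenerator hP ω

end ModuleInduction

/-! ### Compatibility of tensor induction with isomorphisms, tensor products and `End` -/

section Isomorphisms

open PiTensorProduct

/-- The pure tensor `⨂ a_ω` as an element of `A^{⊗G}`. -/
noncomputable def pureTensor {A : GAlgebra.{u, v, w} H R} (a : ∀ ω, Component H A ω) :
    (tensorInduction H A).carrier :=
  PiTensorProduct.tprod R a

theorem smul_pureTensor {A : GAlgebra.{u, v, w} H R} (g : G) (a : ∀ ω, Component H A ω) :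
    g • pureTensor a = pureTensor (translateFamily H A g a) := by
  have := tensorInductionAct_smul_tprod (R := R) g 1 a
  rw [one_smul, smul_one, one_smul] at this
  exact this

theorem span_range_pureTensor (A : GAlgebra.{u, v, w} H R) :
    Submodule.span R (Set.range (pureTensor (A := A))) = ⊤ :=
  submodule_span_range_tprod_eq_top

namespace GAlgebra.Iso

/-- An algebra isomorphism is an isomorphism of `G`-algebras if it commutes with the action on a
set of elements that spans over `R`. -/
def ofSpan {A B : GAlgebra.{u, v, w} G R} (e : A.carrier ≃ₐ[R] B.carrier) (S : Set A.carrier)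
    (hS : Submodule.span R S = ⊤) (h : ∀ g : G, ∀ a ∈ S, e (g • a) = g • e a) : Iso A B where
  toAlgEquiv := e
  map_smul g a := by
    have ha : a ∈ Submodule.span R S := hS ▸ Submodule.mem_top
    induction ha using Submodule.span_induction with
    | mem a ha => exact h g a ha
    | zero => simp
    | add a b _ _ ha hb => rw [smul_add, map_add, ha, hb, map_add, smul_add]
    | smul r a _ ha =>
      rw [smul_distrib_smul g r a, _root_.map_smul, ha, _root_.map_smul,
        smul_distrib_smul g r (e a)]

/-- Tensor induction is functorial for isomorphisms. -/
noncomputable def tensorInductionCongr {A B : GAlgebra.{u, v, w} H R} (e : Iso A B) :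
    Iso (tensorInduction H A) (tensorInduction H B) :=
  let E : (tensorInduction H A).carrier ≃ₐ[R] (tensorInduction H B).carrier :=
    piTensorCongr fun ω => Component.congr e ω
  ofSpan E _ (span_range_pureTensor A) <| by
    have key (a : ∀ ω, Component H A ω) :
        E (pureTensor a) = pureTensor fun ω => Component.congr e ω (a ω) :=
      piTensorCongr_tprod _ a
    rintro g _ ⟨a, rfl⟩
    rw [smul_pureTensor, key, key, smul_pureTensor]
    rfl

/-- Tensor induction commutes with tensor products. -/
noncomputable def tensorInductionTensor [H.FiniteIndex] (A B : GAlgebra.{u, v, w} H R) :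
    Iso ((tensorInduction H A).tensor (tensorInduction H B)) (tensorInduction H (A.tensor B)) :=
  have := Subgroup.finite_quotient_of_finiteIndex (H := H)
  let E : ((tensorInduction H A).tensor (tensorInduction H B)).carrier ≃ₐ[R]
      (tensorInduction H (A.tensor B)).carrier :=
    (tensorPiEquiv R (Component H A) (Component H B)).trans
      (piTensorCongr fun ω => Component.tensorEquiv A B ω)
  ofSpan E
    (Set.image2 (fun x y => x ⊗ₜ[R] y) (Set.range (pureTensor (A := A)))
      (Set.range (pureTensor (A := B))))
    (by
      refine (Submodule.map₂_span_span R (TensorProduct.mk R _ _) _ _).symm.trans ?_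
      rw [span_range_pureTensor, span_range_pureTensor]
      exact TensorProduct.map₂_mk_top_top_eq_top R _ _)
    (by
      have key (a : ∀ ω, Component H A ω) (b : ∀ ω, Component H B ω) :
          E (pureTensor a ⊗ₜ[R] pureTensor b) =
            pureTensor fun ω => Component.tensorHom A B ω (a ω ⊗ₜ b ω) :=
        (congrArg (piTensorCongr fun ω => Component.tensorEquiv A B ω)
          (tensorPiEquiv_tmul a b)).trans (piTensorCongr_tprod _ _)
      rintro g _ ⟨_, ⟨a, rfl⟩, _, ⟨b, rfl⟩, rfl⟩
      have h1 : g • (show ((tensorInduction H A).tensor (tensorInduction H B)).carrier from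
          pureTensor a ⊗ₜ[R] pureTensor b) =
          pureTensor (translateFamily H A g a) ⊗ₜ[R] pureTensor (translateFamily H B g b) :=
        congrArg₂ (· ⊗ₜ[R] ·) (smul_pureTensor g a) (smul_pureTensor g b)
      refine (congrArg E h1).trans ((key _ _).trans (Eq.symm ?_))
      refine (congrArg (g • ·) (key a b)).trans ((smul_pureTensor g _).trans ?_)
      refine congrArg pureTensor (funext fun ω => Component.ext fun x => ?_)
      rw [Component.tensorHom_tmul_val]
      exact Component.tensorHom_tmul_val _ _ _)

/-- Tensor induction commutes with the formation of endomorphism algebras of progenerators. -/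
noncomputable def tensorInductionEnd [H.FiniteIndex] (P : GModule.{u, v, w} H R)
    (hP : IsProgenerator R P.carrier) :
    Iso (tensorInduction H P.endAlgebra) (moduleTensorInduction H P).endAlgebra :=
  have := Subgroup.finite_quotient_of_finiteIndex (H := H)
  have := fun ω => (ModuleComponent.isProgenerator hP ω).finite
  have := fun ω => (ModuleComponent.isProgenerator hP ω).projective
  let E : (tensorInduction H P.endAlgebra).carrier ≃ₐ[R]
      Module.End R (moduleTensorInduction H P).carrier :=
    (piTensorCongr fun ω => endComponentEquiv P ω).trans (endPiEquiv R (ModuleComponent H P))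
  ofSpan (B := (moduleTensorInduction H P).endAlgebra) E _ (span_range_pureTensor _) <| by
    have key (φ : ∀ ω, Component H P.endAlgebra ω) (p : ∀ ω, ModuleComponent H P ω) :
        E (pureTensor φ) (modulePureTensor H p) =
          modulePureTensor H fun ω => endComponentHom P ω (φ ω) (p ω) := by
      have h1 : E (pureTensor φ) = PiTensorProduct.map fun ω => endComponentHom P ω (φ ω) :=
        (congrArg (endPiEquiv R (ModuleComponent H P)) (piTensorCongr_tprod _ φ)).trans
          (endPiEquiv_tprod _)
      rw [h1]
      exact PiTensorProduct.map_tprod _ _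
    rintro g _ ⟨φ, rfl⟩
    rw [smul_pureTensor]
    refine PiTensorProduct.ext (MultilinearMap.ext fun p => ?_)
    -- writing `p = g q` avoids comparing the components at `ω` and at `g g⁻¹ ω`
    obtain ⟨q, rfl⟩ : ∃ q, moduleTranslateFamily H P g q = p :=
      ⟨moduleTranslateFamily H P g⁻¹ p, by
        rw [← moduleTranslateFamily_mul, mul_inv_cancel, moduleTranslateFamily_one]⟩
    refine (key _ _).trans (Eq.symm ?_)
    change g • E (pureTensor φ) (g⁻¹ • modulePureTensor H (moduleTranslateFamily H P g q)) = _
    rw [← smul_modulePureTensor, inv_smul_smul, key, smul_modulePureTensor]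
    rfl

end GAlgebra.Iso

/-- If `A ⊗ End P ≅ B ⊗ End Q`, then applying tensor induction to this isomorphism gives
`A^{⊗G} ⊗ End P^{⊗G} ≅ B^{⊗G} ⊗ End Q^{⊗G}`. -/
theorem GAlgebra.Equivalent.tensorInduction [H.FiniteIndex] {A B : GAlgebra.{u, v, max u v} H R} :
    A.Equivalent B →
      (tensorInduction H A).Equivalent (BrauerClifford.tensorInduction H B) :=
  fun ⟨P, Q, hP, hQ, ⟨e⟩⟩ =>
  ⟨moduleTensorInduction H P, moduleTensorInduction H Q,
    isProgenerator_moduleTensorInduction H hP, isProgenerator_moduleTensorInduction H hQ,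
    ⟨((Iso.refl _).congr (Iso.tensorInductionEnd P hP).symm).trans <|
      (Iso.tensorInductionTensor A P.endAlgebra).trans <|
      (Iso.tensorInductionCongr e).trans <|
      (Iso.tensorInductionTensor B Q.endAlgebra).symm.trans <|
      (Iso.refl _).congr (Iso.tensorInductionEnd Q hQ)⟩⟩

theorem isAzumaya_tensorInduction [H.FiniteIndex] {A : GAlgebra.{u, v, w} H R}
    (hA : IsAzumaya R A.carrier) : IsAzumaya R (tensorInduction H A).carrier :=
  have := Subgroup.finite_quotient_of_finiteIndex (H := H)
  isAzumaya_piTensor fun ω => Component.isAzumaya hA ω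

end Isomorphisms

/-- The corestriction homomorphism `[A] ↦ [A^{⊗G}]` of Brauer-Clifford groups. -/
noncomputable def BrCliff.cores (R : Type u) [CommRing R] [MulSemiringAction G R]
    (H : Subgroup G) [H.FiniteIndex] : BrCliff H R →* BrCliff G R :=
  MonoidHom.mk' (Quotient.map
      (fun A => ⟨tensorInduction H A.1, isAzumaya_tensorInduction A.2⟩)
      fun _ _ h => GAlgebra.Equivalent.tensorInduction h) fun a b => by
    induction a using Quotient.inductionOn
    induction b using Quotient.inductionOn
    exact Quotient.sound (.of_iso (GAlgebra.Iso.tensorInductionTensor _ _).symm)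

end BrauerClifford

theorem mainTheorem2 (G : Type v) (R : Type u) [Group G] [CommRing R] [MulSemiringAction G R]
    (H : Subgroup G) [H.FiniteIndex] :
    (∀ A B : BrauerClifford.GAlgebra.{u, v, max u v} H R, A.Equivalent B →
      (BrauerClifford.tensorInduction H A).Equivalent (BrauerClifford.tensorInduction H B)) ∧
    ∃ hAz : ∀ A : BrauerClifford.GAlgebra.{u, v, max u v} H R, IsAzumaya R A.carrier →
        IsAzumaya R (BrauerClifford.tensorInduction H A).carrier,
      ∃! cores : BrauerClifford.BrCliff H R →* BrauerClifford.BrCliff G R,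
        ∀ (A : BrauerClifford.GAlgebra.{u, v, max u v} H R) (hA : IsAzumaya R A.carrier),
          cores (BrauerClifford.BrCliff.mk A hA) =
            BrauerClifford.BrCliff.mk (BrauerClifford.tensorInduction H A) (hAz A hA) := by
  refine ⟨fun _ _ h => h.tensorInduction, fun _ h => BrauerClifford.isAzumaya_tensorInduction h,
    BrauerClifford.BrCliff.cores R H, fun _ _ => rfl, fun f hf => MonoidHom.ext fun a => ?_⟩
  induction a using Quotient.inductionOn with
  | h A => exact hf A.1 A.2
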